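/- **Setting.** Let $H,U_1,U_2,W$ be real Hilbert spaces, $A:\mathcal D(A)\subset H\to H$ a positive self-adjoint operator with compact inverse, and $V=\mathcal D(A^{1/2})$ with $\|v\|_V=\|A^{1/2}v\|_H$ and dual $V'$, so that $V\subset H\subset V'$. Let $j_U:V\to U_1$ and $j_W:H\to W$ be bounded linear maps (not necessarily injective); write $\|v\|_{U_1}=\|j_Uv\|_{U_1}$ for $v\in V$ and $\|v\|_W=\|j_Wv\|_W$ for $v\in H$. Let $\tau>0$, $0=t_0<t_1<t_2<\cdots$, $I_n=[t_n,t_{n+1})$, $T_n=t_{n+1}-t_n$, and assume $$T_{2n}\ge\tau,\qquad T_{2n+1}\le\tau\qquad\text{for all } n\in\mathbb N .$$ Let $B_1(t)\in\mathcal L(U_1,V')$ and $B_2(t)\in\mathcal L(U_2,H)$, with adjoints $B_1^*(t):V\to U_1$ and $B_2^*(t):H\to U_2$ (the Hilbert spaces $U_1,U_2,H$ being identified with their duals), satisfy, for every $n\in\mathbb N$: * $B_2=0$ on $I_{2n}$ and $B_1=0$ on $I_{2n+1}$; on $I_{2n+1}$, $B_2$ is the restriction of an element of $C([t_{2n+1},t_{2n+2}];\mathcal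 L(U_2,H))$; * on $I_{2n}$, either $B_1$ is the restriction of an element of $C^1([t_{2n},t_{2n+1}];\mathcal L(U_1,H))$, or $B_1(t)=\sqrt{b(t)}\,C_n$ with $C_n\in\mathcal L(U_1,V')$, $b\in W^{2,\infty}(t_{2n},t_{2n+1})$ and $b>0$ on $I_{2n}$; * there are constants $0<m_{2n}\le M_{2n}$ and $M_{2n+1}>0$ such that (i) $m_{2n}\|v\|_{U_1}^2\le\|B_1^*(t)v\|_{U_1}^2\le M_{2n}\|v\|_{U_1}^2$ for all $t\in I_{2n}$, $v\in V$; (ii) $\|B_2^*(t)v\|_{U_2}^2\le M_{2n+1}\|v\|_W^2$ for all $t\in I_{2n+1}$, $v\in H$. **Weak solutions.** For $w\in C([a,c];V)\cap C^1([a,c];H)$ we say that $z\in L^2(a,c;U_1)$ is $B_1^*w_t$ on $(a,c)$ if $\int_a^{c-h}\big\|B_1^*(s)\tfrac{w(s+h)-w(s)}h-z(s)\big\|_{U_1}^2ds\to0$ as $h\downarrow0$. A *weak solution* $w$ of $$w_{tt}+Aw+B_1(t)B_1^*(t)w_t=0\quad\text{on } (t_{2n},t_{2n+1}) \tag{D$_n$}$$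 is a $w\in C([t_{2n},t_{2n+1}];V)\cap C^1([t_{2n},t_{2n+1}];H)$ such that $B_1^*w_t\in L^2(t_{2n},t_{2n+1};U_1)$ exists in this sense and, for all $\varphi\in V$ and $t\in[t_{2n},t_{2n+1}]$, $$(w_t(t),\varphi)_H-(w_t(t_{2n}),\varphi)_H+\int_{t_{2n}}^{t}\big[(w,\varphi)_V+(B_1^*w_t,B_1^*(s)\varphi)_{U_1}\big]ds=0 .$$ A *solution* $u$ of $$u_{tt}(t)+Au(t)+B_1(t)B_1^*(t)u_t(t)+B_2(t)B_2^*(t)u_t(t-\tau)=0,\quad t>0, \tag{P}$$ is a $u\in C([0,\infty);V)\cap C^1([0,\infty);H)$ such that $B_1^*u_t\in L^2(t_n,t_{n+1};U_1)$ exists on every $(t_n,t_{n+1})$ and, for all $\varphi\in V$ and $t\ge0$, $$(u_t(t),\varphi)_H-(u_t(0),\varphi)_H+\int_0^t\big[(u,\varphi)_V+(B_1^*u_t,B_1^*(s)\varphi)_{U_1}+(B_2(s)B_2^*(s)u_t(s-\tau),\varphi)_H\big]ds=0 ;$$ no values of $u_t$ at negative times are needed, because $B_2=0$ on $[0,t_1)$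 and $t_1\ge\tau$. The standard energy is $E_S(w,t)=\frac12\big(\|w(t)\|_V^2+\|w_t(t)\|_H^2\big)$. **Observability hypothesis.** For every $n$ there is $\overline T_n\ge0$ with $\overline T_n<T_{2n}$ such that for every $T\in(\overline T_n,T_{2n}]$ there is a constant $d_n(T)>0$ with $$E_S(w,t_{2n}+T)\le d_n(T)\int_{t_{2n}}^{t_{2n}+T}\|B_1^*w_t(t)\|_{U_1}^2\,dt$$ for every weak solution $w$ of (D$_n$), with arbitrary initial data in $V\times H$ at $t_{2n}$. Put $d_n=d_n(T_{2n})$. **Theorem.** If $$\sum_{n=0}^\infty M_{2n+1}T_{2n+1}<+\infty\qquad\text{and}\qquad\sum_{n=0}^\infty\ln\frac{d_n}{d_n+1}=-\infty,$$ then every solution $u$ of (P), with arbitrary initial data $(u(0),u_t(0))\in V\times H$, satisfies $E_S(u,t)\to0$ as $t\to+\infty$. -/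

import Mathlib

open Set Filter Topology MeasureTheory
open scoped ContDiff

/-- A (densely defined) positive self-adjoint operator on `H` which is onto, one-to-one and has a
compact bounded inverse. Density of the domain is part of `IsSelfAdjoint` for partial maps
(`IsSelfAdjoint.dense_domain`). -/
structure IsPosSelfAdjointCompactInverse {H : Type*} [NormedAddCommGroup H]
    [InnerProductSpace ℝ H] [CompleteSpace H] (A : H →ₗ.[ℝ] H) : Prop where
  selfAdjoint : IsSelfAdjoint A
  nonneg : ∀ x : A.domain, 0 ≤ inner ℝ (A x) (x : H)
  compact_inverse : ∃ G : H →L[ℝ] H, IsCompactOperator G ∧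
    (∀ y : H, ∃ h : G y ∈ A.domain, A ⟨G y, h⟩ = y) ∧ ∀ x : A.domain, G (A x) = x

/-- `S = A^{1/2}`: `S` is the positive self-adjoint operator with `S ∘ S = A`, where the domain of
`S ∘ S` is the set of `x ∈ D(S)` with `S x ∈ D(S)`. A positive self-adjoint operator has exactly
one such square root. -/
structure IsPosSqrt {H : Type*} [NormedAddCommGroup H]
    [InnerProductSpace ℝ H] [CompleteSpace H] (S A : H →ₗ.[ℝ] H) : Prop where
  selfAdjoint : IsSelfAdjoint S
  nonneg : ∀ x : S.domain, 0 ≤ inner ℝ (S x) (x : H)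
  mem_domain_iff : ∀ x : H, x ∈ A.domain ↔ ∃ hx : x ∈ S.domain, S ⟨x, hx⟩ ∈ S.domain
  sq_eq : ∀ (x : H) (hA : x ∈ A.domain) (hS : x ∈ S.domain) (hSS : S ⟨x, hS⟩ ∈ S.domain),
    S ⟨S ⟨x, hS⟩, hSS⟩ = A ⟨x, hA⟩

/-- For `S = A^{1/2}` this is the space `V = D(A^{1/2})`, with the inner product
`(u, v)_V = (A^{1/2} u, A^{1/2} v)_H` and the norm `‖u‖_V = ‖A^{1/2} u‖_H`
(not the topology inherited from `H`). -/
def EnergySpace {H : Type*} [NormedAddCommGroup H] [InnerProductSpace ℝ H]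
    (S : H →ₗ.[ℝ] H) : Type _ := S.domain

namespace EnergySpace

variable {H : Type*} [NormedAddCommGroup H] [InnerProductSpace ℝ H] (S : H →ₗ.[ℝ] H)

instance : AddCommGroup (EnergySpace S) := inferInstanceAs (AddCommGroup S.domain)

instance : Module ℝ (EnergySpace S) := inferInstanceAs (Module ℝ S.domain)

/-- The inclusion `V ⊆ H`. -/
def toH : EnergySpace S →ₗ[ℝ] H := S.domain.subtype

/-- The operator `S = A^{1/2}` on `V`. -/
def sqrtMap : EnergySpace S →ₗ[ℝ] H := S.toFun

noncomputable instance : SeminormedAddCommGroup (EnergySpace S) :=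
  SeminormedAddCommGroup.induced (EnergySpace S) H (sqrtMap S)

noncomputable instance : InnerProductSpace ℝ (EnergySpace S) where
  __ := NormedSpace.induced ℝ (EnergySpace S) H (sqrtMap S)
  inner u v := inner ℝ (sqrtMap S u) (sqrtMap S v)
  norm_sq_eq_re_inner u := norm_sq_eq_re_inner (𝕜 := ℝ) (sqrtMap S u)
  conj_inner_symm u v := inner_conj_symm (𝕜 := ℝ) (sqrtMap S u) (sqrtMap S v)
  add_left u v w := by
    show inner ℝ (sqrtMap S (u + v)) (sqrtMap S w) = _
    rw [map_add, inner_add_left]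
  smul_left u v r := by
    show inner ℝ (sqrtMap S (r • u)) (sqrtMap S v) = _
    rw [map_smul, inner_smul_left]

end EnergySpace

/-- The adjoint `B^* : V → U` of a bounded operator `B : U → V'`, where `U` is identified with its
dual: `(B^* v, x)_U = ⟨B x, v⟩_{V', V}`. -/
noncomputable def dualAdjoint {U V : Type*} [NormedAddCommGroup U] [InnerProductSpace ℝ U]
    [CompleteSpace U] [SeminormedAddCommGroup V] [NormedSpace ℝ V]
    (B : U →L[ℝ] StrongDual ℝ V) (v : V) : U :=
  (InnerProductSpace.toDual ℝ U).symm (B.flip v)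

theorem inner_dualAdjoint {U V : Type*} [NormedAddCommGroup U] [InnerProductSpace ℝ U]
    [CompleteSpace U] [SeminormedAddCommGroup V] [NormedSpace ℝ V]
    (B : U →L[ℝ] StrongDual ℝ V) (v : V) (x : U) : inner ℝ (dualAdjoint B v) x = B x v := by
  simp [dualAdjoint]

/-- `g` is the weak (distributional) derivative of `f` on the interval `(a, c)`. -/
def HasWeakDerivOn (a c : ℝ) (f g : ℝ → ℝ) : Prop :=
  ∀ ψ : ℝ → ℝ, ContDiff ℝ ∞ ψ → HasCompactSupport ψ → tsupport ψ ⊆ Ioo a c →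
    ∫ s in Ioo a c, f s * deriv ψ s = -∫ s in Ioo a c, g s * ψ s

/-- `f ∈ W^{2,∞}(a, c)`. -/
def MemW2Infty (a c : ℝ) (f : ℝ → ℝ) : Prop :=
  MemLp f ⊤ (volume.restrict (Ioo a c)) ∧ ∃ f' f'' : ℝ → ℝ,
    MemLp f' ⊤ (volume.restrict (Ioo a c)) ∧ MemLp f'' ⊤ (volume.restrict (Ioo a c)) ∧
    HasWeakDerivOn a c f f' ∧ HasWeakDerivOn a c f' f''

section Equation

variable {H : Type*} [NormedAddCommGroup H] [InnerProductSpace ℝ H] [CompleteSpace H]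
  {U₁ : Type*} [NormedAddCommGroup U₁] [InnerProductSpace ℝ U₁] [CompleteSpace U₁]
  {U₂ : Type*} [NormedAddCommGroup U₂] [InnerProductSpace ℝ U₂] [CompleteSpace U₂]
  {S : H →ₗ.[ℝ] H}

/-- Structural assumption on `B₁` on `[a, c)`: either `B₁` is (the restriction of) an element of
`C¹([a, c]; L(U₁, H))`, with `H ⊆ V'` through the inner product of `H`, or
`B₁(s) = √(b(s)) C` with `C ∈ L(U₁, V')`, `b ∈ W^{2,∞}(a, c)` and `b > 0` on `[a, c)`. -/
def AdmissibleDamping (B₁ : ℝ → U₁ →L[ℝ] StrongDual ℝ (EnergySpace S)) (a c : ℝ) : Prop :=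
  (∃ F : ℝ → U₁ →L[ℝ] H, ContDiffOn ℝ 1 F (Icc a c) ∧
    ∀ s ∈ Ico a c, ∀ (x : U₁) (φ : EnergySpace S),
      B₁ s x φ = inner ℝ (F s x) (EnergySpace.toH S φ)) ∨
  (∃ (b : ℝ → ℝ) (C : U₁ →L[ℝ] StrongDual ℝ (EnergySpace S)),
    MemW2Infty a c b ∧ (∀ s ∈ Ico a c, 0 < b s) ∧ ∀ s ∈ Ico a c, B₁ s = √(b s) • C)

/-- `z = B₁^* w_t` in `L²(a, c; U₁)` for `w ∈ C([a, c]; V)`. As `w_t(s)` lies only in `H`, while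
`B₁^*(s)` acts on `V`, the time derivative is taken in `L²`: `z` is the limit in `L²`, as `h ↓ 0`,
of the difference quotients `B₁^*(s) ((w(s + h) - w(s)) / h)`. -/
def HasVelocityTrace (B₁ : ℝ → U₁ →L[ℝ] StrongDual ℝ (EnergySpace S)) (a c : ℝ)
    (w : ℝ → EnergySpace S) (z : ℝ → U₁) : Prop :=
  MemLp z 2 (volume.restrict (Ioo a c)) ∧
  Tendsto (fun h : ℝ => ∫⁻ s in Ioo a (c - h),
    ‖dualAdjoint (B₁ s) (h⁻¹ • (w (s + h) - w s)) - z s‖ₑ ^ 2) (𝓝[>] 0) (𝓝 0)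

/-- Weak form of `w_tt + A w + B₁ z + f = 0` on the time interval `J` with left end point `a ∈ J`,
for `w ∈ C(J; V) ∩ C¹(J; H)` with `w_t = w'`, tested with all `φ ∈ V` and integrated in time from
`a`; here `⟨A w, φ⟩ = (w, φ)_V`. The initial data are `w a ∈ V` and `w' a ∈ H`. -/
structure IsWeakSolution (B₁ : ℝ → U₁ →L[ℝ] StrongDual ℝ (EnergySpace S)) (f : ℝ → H)
    (a : ℝ) (J : Set ℝ) (w : ℝ → EnergySpace S) (w' : ℝ → H) (z : ℝ → U₁) : Prop where
  continuousOn : ContinuousOn w J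
  continuousOn_deriv : ContinuousOn w' J
  hasDeriv : ∀ s ∈ J, HasDerivWithinAt (fun r => EnergySpace.toH S (w r)) (w' s) J s
  weak_eq : ∀ φ : EnergySpace S, ∀ s ∈ J,
    inner ℝ (w' s) (EnergySpace.toH S φ) - inner ℝ (w' a) (EnergySpace.toH S φ) +
      ∫ r in a..s, (inner ℝ (w r) φ + inner ℝ (z r) (dualAdjoint (B₁ r) φ) +
        inner ℝ (f r) (EnergySpace.toH S φ)) = 0

/-- Weak solution of the damped system without delay `w_tt + A w + B₁ B₁^* w_t = 0` on `[a, c]`,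
with `w' = w_t` and `z = B₁^* w_t`. -/
def IsDampedSolution (B₁ : ℝ → U₁ →L[ℝ] StrongDual ℝ (EnergySpace S)) (a c : ℝ)
    (w : ℝ → EnergySpace S) (w' : ℝ → H) (z : ℝ → U₁) : Prop :=
  HasVelocityTrace B₁ a c w z ∧ IsWeakSolution B₁ (fun _ => 0) a (Icc a c) w w' z

/-- Weak solution of `u_tt + A u + B₁ B₁^* u_t + B₂ B₂^* u_t(· - τ) = 0` on `[0, ∞)`, with
`u' = u_t`, where `z = B₁^* u_t` on each of the intervals `(t n, t (n + 1))`. -/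
def IsDelaySolution (B₁ : ℝ → U₁ →L[ℝ] StrongDual ℝ (EnergySpace S)) (B₂ : ℝ → U₂ →L[ℝ] H)
    (τ : ℝ) (t : ℕ → ℝ) (u : ℝ → EnergySpace S) (u' : ℝ → H) (z : ℝ → U₁) : Prop :=
  (∀ n, HasVelocityTrace B₁ (t n) (t (n + 1)) u z) ∧
  IsWeakSolution B₁ (fun s => B₂ s (ContinuousLinearMap.adjoint (B₂ s) (u' (s - τ)))) 0 (Ici 0)
    u u' z

/-- The standard energy `E_S = (‖u‖_V² + ‖u_t‖_H²) / 2`. -/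
noncomputable def standardEnergy (v : EnergySpace S) (v' : H) : ℝ :=
  (‖v‖ ^ 2 + ‖v'‖ ^ 2) / 2

end Equation

/-! Write `E` for the energy and `x n = √(E (t (2n)))`. On an even interval the delay is off and the
energy identity says that `E` loses exactly `∫ ‖z‖²`. With the observability inequality this gives
`E (t (2n+1)) ≤ d/(d+1) * E (t (2n))`. On an odd interval the delayed argument falls into the
preceding even interval, where `E ≤ E (t (2n))`, so the delay term adds at most `ε n * x n` to `√E`,
with `ε n = 2‖jW‖² M T`. Hence `x (n+1) ≤ (√(d/(d+1)) + ε n) * x n`. The logarithmic condition makes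
the products of the `√(d/(d+1))` tend to zero, and a summable perturbation does not destroy this
(`tendsto_zero_of_le_add_mul`).

The analytic weight lies in the energy identity (`standardEnergy_sub_eq_neg_integral`). The velocity
lies only in `H`, so it is not an admissible test function. The equation is tested instead with the
difference quotient of `w` over a time step `h`, which lies in `V`. This yields an exact balance for
the energy of the time average of `w` over `[s, s + h]`, and `h ↓ 0` gives the identity: averages of
the force converge in `L²`, and the difference quotients converge in `L²` by the definition of the
velocity trace. Both kinds of damping reduce to this balance, with different observation maps `L`.
-/

/-! ### Translations, averages and inner products in `L²`. -/

/-- Translation acts continuously on `L²`; the rest converts the `Lp` distance into a lower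
integral. -/
theorem tendsto_lintegral_translation_sub {X : Type*} [NormedAddCommGroup X] {G : ℝ → X}
    (hG : MemLp G 2 volume) :
    Tendsto (fun k : ℝ => ∫⁻ s, ‖G (s + k) - G s‖ₑ ^ 2) (𝓝 0) (𝓝 0) := by
  have : Fact ((2 : ENNReal) ≠ ⊤) := ⟨by norm_num⟩
  have h1 : Tendsto (fun k : ℝ => (DomAddAct.mk k +ᵥ hG.toLp G : Lp X 2 (volume : Measure ℝ)))
      (𝓝 0) (𝓝 (hG.toLp G)) := by
    have : Continuous (fun k : ℝ =>
      (DomAddAct.mk k +ᵥ hG.toLp G : Lp X 2 (volume : Measure ℝ))) :=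
      DomAddAct.continuous_mk.vadd continuous_const
    simpa using this.tendsto 0
  have h2 : Tendsto (fun k : ℝ => eLpNorm (fun s => G (s + k) - G s) 2 volume) (𝓝 0) (𝓝 0) := by
    have h3 := (tendsto_iff_edist_tendsto_0.1 h1)
    refine h3.congr fun k => ?_
    rw [DomAddAct.mk_vadd_toLp, Lp.edist_toLp_toLp]
    refine eLpNorm_congr_ae (Eventually.of_forall fun s => ?_)
    simp [add_comm]
  have h4 := ((ENNReal.continuous_pow 2).tendsto _).comp h2
  simp only [ne_eq, OfNat.ofNat_ne_zero, not_false_eq_true, zero_pow] at h4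
  refine h4.congr fun k => ?_
  have := eLpNorm_nnreal_pow_eq_lintegral (μ := (volume : Measure ℝ)) (p := 2)
    (f := fun s => G (s + k) - G s) two_ne_zero
  simpa using this

theorem lintegral_sq_le_measure_mul {α : Type*} [MeasurableSpace α] (μ : Measure α)
    {f : α → ENNReal} (hf : AEMeasurable f μ) :
    (∫⁻ x, f x ∂μ) ^ 2 ≤ μ univ * ∫⁻ x, f x ^ 2 ∂μ := by
  have h := ENNReal.lintegral_mul_le_Lp_mul_Lq μ (Real.HolderConjugate.two_two)
    (aemeasurable_const (b := (1 : ENNReal))) hf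
  simp only [Pi.mul_apply, one_mul, lintegral_const, ENNReal.rpow_ofNat,
    one_pow] at h
  calc _ ≤ _ := pow_le_pow_left' h 2
    _ = _ := by
      rw [mul_pow, ← ENNReal.rpow_mul_natCast, ← ENNReal.rpow_mul_natCast]
      norm_num

/-- By Cauchy–Schwarz the squared error at `s` is at most the mean over `k ∈ (0, h]` of `‖G (s + k)
- G s‖²`. Tonelli then bounds the total error by a mean of translation errors, which are small
uniformly for small `k`. -/
theorem tendsto_lintegral_average_sub {X : Type*} [NormedAddCommGroup X] [NormedSpace ℝ X]
    [CompleteSpace X] {G : ℝ → X} (hG : MemLp G 2 volume) :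
    Tendsto (fun h : ℝ => ∫⁻ s, ‖(h⁻¹ • ∫ r in s..s + h, G r) - G s‖ₑ ^ 2) (𝓝[>] 0) (𝓝 0) := by
  -- A strongly measurable representative makes the integrand jointly measurable in `(s, k)`, as
  -- Tonelli requires.
  wlog hm : StronglyMeasurable G generalizing G
  · have hae := hG.1.ae_eq_mk
    refine (this ((memLp_congr_ae hae).1 hG) hG.1.stronglyMeasurable_mk).congr fun h => ?_
    refine lintegral_congr_ae ?_
    filter_upwards [hae] with s hs
    have : ∫ r in s..s + h, hG.1.mk G r = ∫ r in s..s + h, G r :=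
      intervalIntegral.integral_congr_ae (hae.mono fun r hr _ => hr.symm)
    rw [this, hs]
  have hloc : LocallyIntegrable G volume := hG.locallyIntegrable (by norm_num)
  have hmeas : Measurable (fun p : ℝ × ℝ => ‖G (p.1 + p.2) - G p.1‖ₑ ^ 2) :=
    (((hm.comp_measurable (measurable_fst.add measurable_snd)).sub
      (hm.comp_measurable measurable_fst)).enorm).pow_const 2
  have hT := tendsto_lintegral_translation_sub hG
  refine ENNReal.tendsto_nhds_zero.2 fun ε hε => ?_
  obtain ⟨δ, hδ, hball⟩ := Metric.eventually_nhds_iff.1 (ENNReal.tendsto_nhds_zero.1 hT ε hε)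
  filter_upwards [Ioo_mem_nhdsGT hδ] with h hh
  have hh0 : 0 < h := hh.1
  have hone : ENNReal.ofReal h⁻¹ * ENNReal.ofReal h = 1 := by
    rw [← ENNReal.ofReal_mul (by positivity), inv_mul_cancel₀ hh0.ne', ENNReal.ofReal_one]
  have hpt : ∀ s, ‖(h⁻¹ • ∫ r in s..s + h, G r) - G s‖ₑ ^ 2 ≤
      ENNReal.ofReal h⁻¹ * ∫⁻ k in Ioc 0 h, ‖G (s + k) - G s‖ₑ ^ 2 := by
    intro s
    have hint : IntervalIntegrable (fun k => G (s + k)) volume 0 h := by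
      have := ((hloc.integrableOn_isCompact isCompact_uIcc).intervalIntegrable
        (a := s) (b := s + h)).comp_add_left s
      simpa using this
    have e1 : (h⁻¹ • ∫ r in s..s + h, G r) - G s
        = h⁻¹ • ∫ k in Ioc 0 h, (G (s + k) - G s) := by
      rw [← intervalIntegral.integral_of_le hh0.le, intervalIntegral.integral_sub hint (by simp),
        intervalIntegral.integral_comp_add_left (fun r => G r) s, intervalIntegral.integral_const,
        smul_sub, smul_smul]
      simp [hh0.ne']
    have hms : Measurable (fun k => ‖G (s + k) - G s‖ₑ) :=
      ((hm.comp_measurable (measurable_const.add measurable_id)).sub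
        stronglyMeasurable_const).enorm
    calc ‖(h⁻¹ • ∫ r in s..s + h, G r) - G s‖ₑ ^ 2
        ≤ (ENNReal.ofReal h⁻¹ * ∫⁻ k in Ioc 0 h, ‖G (s + k) - G s‖ₑ) ^ 2 := by
          rw [e1, enorm_smul, Real.enorm_of_nonneg (by positivity)]
          gcongr
          exact enorm_integral_le_lintegral_enorm _
      _ ≤ ENNReal.ofReal h⁻¹ ^ 2 *
          (ENNReal.ofReal h * ∫⁻ k in Ioc 0 h, ‖G (s + k) - G s‖ₑ ^ 2) := by
          rw [mul_pow]
          gcongr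
          simpa using lintegral_sq_le_measure_mul (volume.restrict (Ioc 0 h)) hms.aemeasurable
      _ = (ENNReal.ofReal h⁻¹ * ENNReal.ofReal h) *
          (ENNReal.ofReal h⁻¹ * ∫⁻ k in Ioc 0 h, ‖G (s + k) - G s‖ₑ ^ 2) := by ring
      _ = _ := by rw [hone, one_mul]
  calc ∫⁻ s, ‖(h⁻¹ • ∫ r in s..s + h, G r) - G s‖ₑ ^ 2
      ≤ ∫⁻ s, ENNReal.ofReal h⁻¹ * ∫⁻ k in Ioc 0 h, ‖G (s + k) - G s‖ₑ ^ 2 :=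
        lintegral_mono hpt
    _ = ENNReal.ofReal h⁻¹ * ∫⁻ k in Ioc 0 h, ∫⁻ s, ‖G (s + k) - G s‖ₑ ^ 2 := by
        rw [lintegral_const_mul' _ _ ENNReal.ofReal_ne_top,
          lintegral_lintegral_swap hmeas.aemeasurable]
    _ ≤ ENNReal.ofReal h⁻¹ * ∫⁻ k in Ioc 0 h, ε := by
        refine mul_le_mul_right ?_ _
        refine setLIntegral_mono measurable_const fun k hk => hball ?_
        rw [Real.dist_eq, sub_zero, abs_of_pos hk.1]
        exact hk.2.trans_lt hh.2
    _ = ε := by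
        rw [setLIntegral_const, Real.volume_Ioc, sub_zero, mul_comm ε, ← mul_assoc, hone, one_mul]

/-- A measurable function at finite `L²` distance from an `L²` function is itself in `L²`, so both
families eventually live in `Lp`, where the inner product is continuous. -/
theorem tendsto_integral_inner_of_eLpNorm {α ι E : Type*} [MeasurableSpace α] {μ : Measure α}
    [NormedAddCommGroup E] [InnerProductSpace ℝ E] {l : Filter ι} {F Y : ι → α → E} {f y : α → E}
    (hF : ∀ᶠ i in l, AEStronglyMeasurable (F i) μ) (hf : MemLp f 2 μ)
    (hY : ∀ᶠ i in l, AEStronglyMeasurable (Y i) μ) (hy : MemLp y 2 μ)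
    (hFf : Tendsto (fun i => ∫⁻ x, ‖F i x - f x‖ₑ ^ 2 ∂μ) l (𝓝 0))
    (hYy : Tendsto (fun i => ∫⁻ x, ‖Y i x - y x‖ₑ ^ 2 ∂μ) l (𝓝 0)) :
    Tendsto (fun i => ∫ x, inner ℝ (F i x) (Y i x) ∂μ) l (𝓝 (∫ x, inner ℝ (f x) (y x) ∂μ)) := by
  have key : ∀ {F : ι → α → E} {f : α → E}, (∀ᶠ i in l, AEStronglyMeasurable (F i) μ) →
      ∀ hf : MemLp f 2 μ, Tendsto (fun i => ∫⁻ x, ‖F i x - f x‖ₑ ^ 2 ∂μ) l (𝓝 0) →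
      ∃ Φ : ι → Lp E 2 μ, (∀ᶠ i in l, Φ i =ᵐ[μ] F i) ∧ Tendsto Φ l (𝓝 (hf.toLp f)) := by
    intro F f hF hf hFf
    classical
    have hnorm : Tendsto (fun i => eLpNorm (F i - f) 2 μ) l (𝓝 0) := by
      have h4 := ((ENNReal.continuous_rpow_const (y := (2 : ℝ)⁻¹)).tendsto _).comp hFf
      rw [ENNReal.zero_rpow_of_pos (by norm_num)] at h4
      refine h4.congr fun i => ?_
      rw [eLpNorm_eq_lintegral_rpow_enorm_toReal (by norm_num) (by norm_num)]
      simp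
    have hmem : ∀ᶠ i in l, MemLp (F i) 2 μ := by
      filter_upwards [hF, hnorm.eventually (gt_mem_nhds ENNReal.zero_lt_top)] with i h1 h2
      have : MemLp (F i - f) 2 μ := ⟨h1.sub hf.1, h2⟩
      simpa using this.add hf
    refine ⟨fun i => if h : MemLp (F i) 2 μ then h.toLp (F i) else 0, ?_, ?_⟩
    · filter_upwards [hmem] with i hi
      rw [dif_pos hi]
      exact hi.coeFn_toLp
    · rw [tendsto_iff_edist_tendsto_0]
      refine hnorm.congr' ?_
      filter_upwards [hmem] with i hi
      rw [dif_pos hi, Lp.edist_toLp_toLp]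
  obtain ⟨Φ, hΦ, hΦt⟩ := key hF hf hFf
  obtain ⟨Ψ, hΨ, hΨt⟩ := key hY hy hYy
  have h := hΦt.inner (𝕜 := ℝ) hΨt
  simp only [L2.inner_def] at h
  have e : ∫ x, inner ℝ (hf.toLp f x) (hy.toLp y x) ∂μ = ∫ x, inner ℝ (f x) (y x) ∂μ := by
    refine integral_congr_ae ?_
    filter_upwards [hf.coeFn_toLp, hy.coeFn_toLp] with x h1 h2
    rw [h1, h2]
  rw [e] at h
  refine h.congr' ?_
  filter_upwards [hΦ, hΨ] with i h1 h2
  refine integral_congr_ae ?_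
  filter_upwards [h1, h2] with x h1 h2
  rw [h1, h2]

/-! ### Difference quotients in time and the energy balance. -/

theorem ContinuousOn.comp_add_const_Icc {E : Type*} [TopologicalSpace E] {f : ℝ → E} {a c h : ℝ}
    (hf : ContinuousOn f (Icc a c)) (h0 : 0 < h) :
    ContinuousOn (fun s => f (s + h)) (Icc a (c - h)) :=
  hf.comp (by fun_prop) fun s hs => ⟨by linarith [hs.1], by linarith [hs.2]⟩

theorem tendsto_slope_left_end {E : Type*} [NormedAddCommGroup E] [NormedSpace ℝ E] {P : ℝ → E}
    {v : E} {a c : ℝ} (hac : a < c) (hP : HasDerivWithinAt P v (Icc a c) a) :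
    Tendsto (fun h : ℝ => h⁻¹ • (P (a + h) - P a)) (𝓝[>] 0) (𝓝 v) := by
  have h1 := (hasDerivWithinAt_iff_tendsto_slope.1 hP)
  have h2 : Tendsto (fun h : ℝ => a + h) (𝓝[>] 0) (𝓝[Icc a c \ {a}] a) := by
    refine tendsto_nhdsWithin_iff.2 ⟨?_, ?_⟩
    · exact (Continuous.tendsto' (by fun_prop) 0 a (by simp)).mono_left nhdsWithin_le_nhds
    · filter_upwards [Ioo_mem_nhdsGT (sub_pos.2 hac)] with h hh
      exact ⟨⟨by linarith [hh.1], by linarith [hh.2]⟩, by simpa using hh.1.ne'⟩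
  refine (h1.comp h2).congr fun h => ?_
  simp [slope]

theorem tendsto_slope_right_end {E : Type*} [NormedAddCommGroup E] [NormedSpace ℝ E] {P : ℝ → E}
    {v : E} {a c : ℝ} (hac : a < c) (hP : HasDerivWithinAt P v (Icc a c) c) :
    Tendsto (fun h : ℝ => h⁻¹ • (P (c - h + h) - P (c - h))) (𝓝[>] 0) (𝓝 v) := by
  have h1 := (hasDerivWithinAt_iff_tendsto_slope.1 hP)
  have h2 : Tendsto (fun h : ℝ => c - h) (𝓝[>] 0) (𝓝[Icc a c \ {c}] c) := by
    refine tendsto_nhdsWithin_iff.2 ⟨?_, ?_⟩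
    · exact (Continuous.tendsto' (by fun_prop) 0 c (by simp)).mono_left nhdsWithin_le_nhds
    · filter_upwards [Ioo_mem_nhdsGT (sub_pos.2 hac)] with h hh
      exact ⟨⟨by linarith [hh.2], by linarith [hh.1]⟩, by simpa using hh.1.ne'⟩
  refine (h1.comp h2).congr fun h => ?_
  simp only [Function.comp, slope, sub_sub_cancel_left, vsub_eq_sub, sub_add_cancel, inv_neg,
    neg_smul, ← smul_neg, neg_sub]

theorem hasDerivAt_half_norm_sq_slope {E : Type*} [NormedAddCommGroup E] [InnerProductSpace ℝ E]
    {P P' : ℝ → E} {a c h s : ℝ} (hP : ∀ r ∈ Icc a c, HasDerivWithinAt P (P' r) (Icc a c) r)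
    (h0 : 0 < h) (hs : s ∈ Ioo a (c - h)) :
    HasDerivAt (fun s => ‖h⁻¹ • (P (s + h) - P s)‖ ^ 2 / 2)
      (inner ℝ (h⁻¹ • (P (s + h) - P s)) (h⁻¹ • (P' (s + h) - P' s))) s := by
  have hat : ∀ r ∈ Ioo a c, HasDerivAt P (P' r) r := fun r hr =>
    (hP r (Ioo_subset_Icc_self hr)).hasDerivAt (Icc_mem_nhds hr.1 hr.2)
  have h1 := hat s ⟨hs.1, by linarith [hs.2]⟩
  have h2 := (hat (s + h) ⟨by linarith [hs.1], by linarith [hs.2]⟩).comp_add_const s h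
  have h3 := (((h2.sub h1).const_smul h⁻¹).norm_sq).div_const 2
  refine h3.congr_deriv ?_
  simp

namespace EnergySpace

variable {H : Type*} [NormedAddCommGroup H] [InnerProductSpace ℝ H] (S : H →ₗ.[ℝ] H)

theorem norm_sqrtMap (v : EnergySpace S) : ‖sqrtMap S v‖ = ‖v‖ := rfl

theorem continuous_sqrtMap : Continuous (sqrtMap S) :=
  AddMonoidHomClass.continuous_of_bound (sqrtMap S) 1 fun v => by rw [norm_sqrtMap, one_mul]

end EnergySpace

/-- Extension by zero trades the shrinking domains `(a, c - h)` for the whole line; the price is the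
integral of `‖Y‖²` over `[c - h, c)`, which vanishes as `h ↓ 0`. -/
theorem tendsto_lintegral_indicator_sub {X : Type*} [NormedAddCommGroup X] {a c : ℝ}
    {Yh : ℝ → ℝ → X} {Y : ℝ → X} (hY : MemLp Y 2 (volume.restrict (Ioo a c)))
    (h : Tendsto (fun h => ∫⁻ s in Ioo a (c - h), ‖Yh h s - Y s‖ₑ ^ 2) (𝓝[>] 0) (𝓝 0)) :
    Tendsto (fun h => ∫⁻ s, ‖(Ioo a (c - h)).indicator (Yh h) s - (Ioo a c).indicator Y s‖ₑ ^ 2)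
      (𝓝[>] 0) (𝓝 0) := by
  have hY' : MemLp ((Ioo a c).indicator Y) 2 volume :=
    (memLp_indicator_iff_restrict measurableSet_Ioo).2 hY
  set Z := (Ioo a c).indicator Y with hZ
  have hfin : ∫⁻ s, ‖Z s‖ₑ ^ 2 ≠ ⊤ := by
    have h2 := eLpNorm_nnreal_pow_eq_lintegral (μ := (volume : Measure ℝ)) (p := 2)
      (f := Z) two_ne_zero
    simp only [ENNReal.coe_ofNat, NNReal.coe_ofNat, ENNReal.rpow_ofNat] at h2
    rw [← h2]
    exact ENNReal.pow_ne_top hY'.eLpNorm_ne_top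
  have hvol : Tendsto (fun h : ℝ => volume (Ico (c - h) c)) (𝓝[>] 0) (𝓝 0) := by
    simp only [Real.volume_Ico, sub_sub_cancel]
    exact (ENNReal.continuous_ofReal.tendsto' 0 0 (by simp)).mono_left nhdsWithin_le_nhds
  have htail := tendsto_setLIntegral_zero hfin hvol
  have hsum := h.add htail
  rw [add_zero] at hsum
  refine tendsto_of_tendsto_of_tendsto_of_le_of_le' tendsto_const_nhds hsum
    (Eventually.of_forall fun _ => zero_le) ?_
  filter_upwards [self_mem_nhdsWithin] with k hk
  have hk : (0 : ℝ) < k := hk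
  rw [← lintegral_indicator measurableSet_Ioo, ← lintegral_indicator measurableSet_Ico,
    ← lintegral_add_right' _ ((hY'.1.enorm.pow_const 2).indicator measurableSet_Ico)]
  refine lintegral_mono fun s => ?_
  by_cases h1 : s ∈ Ioo a (c - k)
  · have h2 : s ∈ Ioo a c := ⟨h1.1, by linarith [h1.2]⟩
    simp [hZ, h1, h2]
  · by_cases h2 : s ∈ Ioo a c
    · have h3 : s ∈ Ico (c - k) c := ⟨not_lt.1 fun h3 => h1 ⟨h2.1, h3⟩, h2.2⟩
      simp [hZ, h1, h2, h3]
    · simp [hZ, h1, h2]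

/-- `G` is the force as seen through `L`, and `Y` is the `L²` time derivative of `L w`. Only
linearity of `L` and continuity of `L ∘ w` are asked, so `L` may be the inclusion into `H` or the
adjoint of a fixed damping operator. -/
theorem standardEnergy_sub_eq_neg_integral
    {H : Type*} [NormedAddCommGroup H] [InnerProductSpace ℝ H] [CompleteSpace H]
    {X : Type*} [NormedAddCommGroup X] [InnerProductSpace ℝ X] [CompleteSpace X]
    {S : H →ₗ.[ℝ] H} (L : EnergySpace S →ₗ[ℝ] X) {a c : ℝ} (hac : a < c)
    {w : ℝ → EnergySpace S} {w' : ℝ → H} {G Y : ℝ → X}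
    (hw : ContinuousOn w (Icc a c))
    (hder : ∀ s ∈ Icc a c,
      HasDerivWithinAt (fun r => EnergySpace.toH S (w r)) (w' s) (Icc a c) s)
    (hL : ContinuousOn (fun s => L (w s)) (Icc a c))
    (hG : MemLp G 2 (volume.restrict (Ioo a c))) (hY : MemLp Y 2 (volume.restrict (Ioo a c)))
    (hLY : Tendsto (fun h : ℝ => ∫⁻ s in Ioo a (c - h),
      ‖L (h⁻¹ • (w (s + h) - w s)) - Y s‖ₑ ^ 2) (𝓝[>] 0) (𝓝 0))
    (hweak : ∀ φ : EnergySpace S, ∀ s ∈ Icc a c,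
      inner ℝ (w' s) (EnergySpace.toH S φ) - inner ℝ (w' a) (EnergySpace.toH S φ) +
        ∫ r in a..s, (inner ℝ (w r) φ + inner ℝ (G r) (L φ)) = 0) :
    standardEnergy (w c) (w' c) - standardEnergy (w a) (w' a) =
      -∫ s in a..c, inner ℝ (G s) (Y s) := by
  set p : ℝ → H := fun r => EnergySpace.toH S (w r) with hp
  have hq : ContinuousOn (fun s => EnergySpace.sqrtMap S (w s)) (Icc a c) :=
    (EnergySpace.continuous_sqrtMap S).comp_continuousOn hw
  -- A continuous extension of `A^{1/2} w` to the line, so that its primitive `Q` is differentiable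
  -- everywhere, end points included.
  obtain ⟨q, hqc, hqw⟩ : ∃ q : ℝ → H, Continuous q ∧
      ∀ s ∈ Icc a c, q s = EnergySpace.sqrtMap S (w s) :=
    ⟨IccExtend hac.le ((Icc a c).domRestrict fun s => EnergySpace.sqrtMap S (w s)),
      (continuousOn_iff_continuous_domRestrict.1 hq).Icc_extend',
      fun s hs => IccExtend_of_mem hac.le _ hs⟩
  set Q : ℝ → H := fun s => ∫ r in a..s, q r
  have hQd : ∀ s, HasDerivAt Q (q s) s := fun s => (hqc.integral_hasStrictDerivAt a s).hasDerivAt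
  have hQd' : ∀ s ∈ Icc a c, HasDerivWithinAt Q (q s) (Icc a c) s :=
    fun s _ => (hQd s).hasDerivWithinAt
  set K : ℝ → X := (Ioo a c).indicator G with hK
  have hKm : MemLp K 2 volume := (memLp_indicator_iff_restrict measurableSet_Ioo).2 hG
  have hKloc : LocallyIntegrable K volume := hKm.locallyIntegrable (by norm_num)
  have hKint : ∀ r s, IntervalIntegrable K volume r s := fun r s =>
    (hKloc.integrableOn_isCompact isCompact_uIcc).intervalIntegrable
  set Yh : ℝ → ℝ → X := fun h s => L (h⁻¹ • (w (s + h) - w s)) with hYh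
  set Av : ℝ → ℝ → X := fun h s => h⁻¹ • ∫ r in s..s + h, K r with hAv
  have hAvc : ∀ h, Continuous (Av h) := by
    intro h
    have h1 : Continuous fun s => ∫ r in a..s, K r :=
      intervalIntegral.continuous_primitive hKint a
    have h2 : Av h = fun s => h⁻¹ • ((∫ r in a..s + h, K r) - ∫ r in a..s, K r) := by
      funext s
      rw [hAv, intervalIntegral.integral_interval_sub_left (hKint _ _) (hKint _ _)]
    rw [h2]
    exact ((h1.comp (continuous_id.add continuous_const)).sub h1).const_smul _
  have hweak' : ∀ φ : EnergySpace S, ∀ s ∈ Icc a c,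
      inner ℝ (w' s) (EnergySpace.toH S φ) - inner ℝ (w' a) (EnergySpace.toH S φ) +
        (inner ℝ (Q s) (EnergySpace.sqrtMap S φ) + inner ℝ (∫ r in a..s, K r) (L φ)) = 0 := by
    intro φ s hs
    rw [← hweak φ s hs]
    congr 1
    have e1 : inner ℝ (Q s) (EnergySpace.sqrtMap S φ)
        = ∫ r in a..s, inner ℝ (q r) (EnergySpace.sqrtMap S φ) := by
      simp only [real_inner_comm (EnergySpace.sqrtMap S φ)]
      exact ((innerSL ℝ (EnergySpace.sqrtMap S φ)).intervalIntegral_comp_comm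
        (hqc.intervalIntegrable a s)).symm
    have e2 : inner ℝ (∫ r in a..s, K r) (L φ) = ∫ r in a..s, inner ℝ (K r) (L φ) := by
      simp only [real_inner_comm (L φ)]
      exact ((innerSL ℝ (L φ)).intervalIntegral_comp_comm (hKint a s)).symm
    rw [e1, e2, ← intervalIntegral.integral_add]
    · rw [intervalIntegral.integral_of_le hs.1, intervalIntegral.integral_of_le hs.1,
        integral_Ioc_eq_integral_Ioo, integral_Ioc_eq_integral_Ioo]
      refine setIntegral_congr_fun measurableSet_Ioo fun r hr => ?_
      have hr' : r ∈ Ioo a c := ⟨hr.1, hr.2.trans_le hs.2⟩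
      simp only [hK, indicator_of_mem hr', hqw r (Ioo_subset_Icc_self hr')]
      rfl
    · exact (hqc.inner continuous_const).intervalIntegrable _ _
    · refine ⟨?_, ?_⟩
      · simpa [IntegrableOn, real_inner_comm] using
          (innerSL ℝ (L φ)).integrable_comp (hKint a s).1
      · simpa [IntegrableOn, real_inner_comm] using
          (innerSL ℝ (L φ)).integrable_comp (hKint a s).2
  -- The energy of the average of `w` over `[s, s + h]`: its velocity is the quotient of `p`, and
  -- its image under `A^{1/2}` is the quotient of `Q`.
  set Φ : ℝ → ℝ → ℝ := fun h s =>
    ‖h⁻¹ • (p (s + h) - p s)‖ ^ 2 / 2 + ‖h⁻¹ • (Q (s + h) - Q s)‖ ^ 2 / 2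
  have hpc : ContinuousOn p (Icc a c) := fun s hs => (hder s hs).continuousWithinAt
  have hYc : ∀ h, 0 < h → ContinuousOn (Yh h) (Icc a (c - h)) := by
    intro h h0
    have : Yh h = fun s => h⁻¹ • (L (w (s + h)) - L (w s)) := by
      funext s; simp [hYh]
    rw [this]
    exact ((hL.comp_add_const_Icc h0).sub
      (hL.mono (Icc_subset_Icc_right (by linarith)))).const_smul _
  have hFTC : ∀ h, 0 < h → h < c - a →
      ∫ s in a..c - h, -inner ℝ (Av h s) (Yh h s) = Φ h (c - h) - Φ h a := by
    intro h h0 h1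
    have hsub : Icc a (c - h) ⊆ Icc a c := Icc_subset_Icc_right (by linarith)
    have hYc := hYc h h0
    refine intervalIntegral.integral_eq_sub_of_hasDerivAt_of_le (by linarith) ?_ ?_ ?_
    · have hp2 : ContinuousOn (fun s => p (s + h)) (Icc a (c - h)) := hpc.comp_add_const_Icc h0
      have hp1 := hpc.mono hsub
      have hQc : Continuous Q := continuous_iff_continuousAt.2 fun s => (hQd s).continuousAt
      have hQ2 : Continuous (fun s => Q (s + h)) := hQc.comp (by fun_prop)
      exact ((((hp2.sub hp1).const_smul _).norm.pow 2).div_const 2).add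
        ((((hQ2.sub hQc).const_smul _).norm.pow 2).div_const 2).continuousOn
    · intro s hs
      have hs1 : s ∈ Icc a c := hsub (Ioo_subset_Icc_self hs)
      have hs2 : s + h ∈ Icc a c := ⟨by linarith [hs.1], by linarith [hs.2]⟩
      refine ((hasDerivAt_half_norm_sq_slope hder h0 hs).add
        (hasDerivAt_half_norm_sq_slope hQd' h0 hs)).congr_deriv ?_
      -- One fixed element of `V` tests the integrated equation at both `s` and `s + h`; the
      -- difference, divided by `h`, is the derivative of `Φ h` at `s`.
      have e1 := hweak' (h⁻¹ • (w (s + h) - w s)) s hs1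
      have e2 := hweak' (h⁻¹ • (w (s + h) - w s)) (s + h) hs2
      have e3 : (EnergySpace.toH S) (h⁻¹ • (w (s + h) - w s)) = h⁻¹ • (p (s + h) - p s) := by
        simp [hp]
      have e4 : (EnergySpace.sqrtMap S) (h⁻¹ • (w (s + h) - w s)) = h⁻¹ • (q (s + h) - q s) := by
        simp [hqw _ hs1, hqw _ hs2]
      have e5 : L (h⁻¹ • (w (s + h) - w s)) = Yh h s := rfl
      rw [e3, e4, e5] at e1 e2
      have e6 : Av h s = h⁻¹ • ((∫ r in a..s + h, K r) - ∫ r in a..s, K r) := by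
        rw [hAv, intervalIntegral.integral_interval_sub_left (hKint _ _) (hKint _ _)]
      have e7 : inner ℝ (h⁻¹ • (p (s + h) - p s)) (h⁻¹ • (w' (s + h) - w' s)) =
          h⁻¹ * (inner ℝ (w' (s + h)) (h⁻¹ • (p (s + h) - p s)) -
            inner ℝ (w' s) (h⁻¹ • (p (s + h) - p s))) := by
        rw [real_inner_smul_right, real_inner_comm, inner_sub_left]
      rw [e7, e6, real_inner_smul_left, inner_sub_left, real_inner_smul_left, inner_sub_left]
      linear_combination h⁻¹ * e2 - h⁻¹ * e1
    · refine ContinuousOn.intervalIntegrable ?_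
      rw [uIcc_of_le (by linarith)]
      exact ((hAvc h).continuousOn.inner hYc).neg
  have hΦlim : Tendsto (fun h => Φ h (c - h) - Φ h a) (𝓝[>] 0)
      (𝓝 (standardEnergy (w c) (w' c) - standardEnergy (w a) (w' a))) := by
    have ha : a ∈ Icc a c := left_mem_Icc.2 hac.le
    have hc : c ∈ Icc a c := right_mem_Icc.2 hac.le
    have e : ∀ s ∈ Icc a c, standardEnergy (w s) (w' s) = ‖w' s‖ ^ 2 / 2 + ‖q s‖ ^ 2 / 2 := by
      intro s hs
      rw [hqw s hs, EnergySpace.norm_sqrtMap, standardEnergy]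
      ring
    rw [e a ha, e c hc]
    exact ((((tendsto_slope_right_end hac (hder c hc)).norm.pow 2).div_const 2).add
      (((tendsto_slope_right_end hac (hQd' c hc)).norm.pow 2).div_const 2)).sub
      ((((tendsto_slope_left_end hac (hder a ha)).norm.pow 2).div_const 2).add
      (((tendsto_slope_left_end hac (hQd' a ha)).norm.pow 2).div_const 2))
  have hYm : MemLp ((Ioo a c).indicator Y) 2 volume :=
    (memLp_indicator_iff_restrict measurableSet_Ioo).2 hY
  have hlim := tendsto_integral_inner_of_eLpNorm (F := Av)
    (Y := fun h => (Ioo a (c - h)).indicator (Yh h))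
    (Eventually.of_forall fun h => (hAvc h).aestronglyMeasurable) hKm
    (eventually_mem_nhdsWithin.mono fun h h0 =>
      (aestronglyMeasurable_indicator_iff measurableSet_Ioo).2
        (((hYc h h0).mono Ioo_subset_Icc_self).aestronglyMeasurable measurableSet_Ioo)) hYm
    (tendsto_lintegral_average_sub hKm) (tendsto_lintegral_indicator_sub hY hLY)
  have e1 : ∫ s, inner ℝ (K s) ((Ioo a c).indicator Y s) = ∫ s in a..c, inner ℝ (G s) (Y s) := by
    rw [intervalIntegral.integral_of_le hac.le, integral_Ioc_eq_integral_Ioo,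
      ← integral_indicator measurableSet_Ioo]
    refine integral_congr_ae (Eventually.of_forall fun s => ?_)
    by_cases hs : s ∈ Ioo a c <;> simp [hK, hs]
  rw [e1] at hlim
  refine tendsto_nhds_unique hΦlim (hlim.neg.congr' ?_)
  filter_upwards [Ioo_mem_nhdsGT (sub_pos.2 hac)] with h hh
  rw [← hFTC h hh.1 hh.2, intervalIntegral.integral_neg, neg_inj,
    intervalIntegral.integral_of_le (by linarith [hh.2]), integral_Ioc_eq_integral_Ioo,
    ← integral_indicator measurableSet_Ioo]
  refine integral_congr_ae (Eventually.of_forall fun s => ?_)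
  by_cases hs : s ∈ Ioo a (c - h) <;> simp [hs]

/-- The slopes converge uniformly, by uniform continuity of `P'` and the mean value inequality for
`r ↦ P r - r • P' s`. -/
theorem tendsto_lintegral_slope_sub {E : Type*} [NormedAddCommGroup E] [NormedSpace ℝ E]
    {P P' : ℝ → E} {a c : ℝ} (hP : ∀ r ∈ Icc a c, HasDerivWithinAt P (P' r) (Icc a c) r)
    (hP' : ContinuousOn P' (Icc a c)) :
    Tendsto (fun h : ℝ => ∫⁻ s in Ioo a (c - h), ‖h⁻¹ • (P (s + h) - P s) - P' s‖ₑ ^ 2)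
      (𝓝[>] 0) (𝓝 0) := by
  have huc := isCompact_Icc.uniformContinuousOn_of_continuous hP'
  have hbound : ∀ ε > 0, ∀ᶠ h : ℝ in 𝓝[>] 0, ∫⁻ s in Ioo a (c - h),
      ‖h⁻¹ • (P (s + h) - P s) - P' s‖ₑ ^ 2 ≤ ENNReal.ofReal ε ^ 2 * volume (Ioo a c) := by
    intro ε hε
    obtain ⟨δ, hδ, hd⟩ := Metric.uniformContinuousOn_iff.1 huc ε hε
    filter_upwards [Ioo_mem_nhdsGT hδ] with h hh
    have h0 : 0 < h := hh.1
    calc _ ≤ ∫⁻ s in Ioo a (c - h), ENNReal.ofReal ε ^ 2 := by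
          refine setLIntegral_mono measurable_const fun s hs => ?_
          refine pow_le_pow_left' ?_ 2
          rw [← ofReal_norm]
          refine ENNReal.ofReal_le_ofReal ?_
          have hsub : Icc s (s + h) ⊆ Icc a c :=
            Icc_subset_Icc hs.1.le (by linarith [hs.2])
          have hs0 : s ∈ Icc s (s + h) := left_mem_Icc.2 (by linarith)
          have hs1 : s + h ∈ Icc s (s + h) := right_mem_Icc.2 (by linarith)
          have hmv := (convex_Icc s (s + h)).norm_image_sub_le_of_norm_hasDerivWithin_le
            (f := fun r => P r - r • P' s) (f' := fun r => P' r - P' s) (C := ε)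
            (fun r hr =>
              (((hP r (hsub hr)).mono hsub).fun_sub
                ((hasDerivWithinAt_id r _).smul_const (P' s))).congr_deriv (by simp))
            (fun r hr => by
              rw [← dist_eq_norm]
              refine (hd r (hsub hr) s (hsub hs0) ?_).le
              rw [Real.dist_eq, abs_of_nonneg (by linarith [hr.1])]
              linarith [hr.2, hh.2]) hs0 hs1
          have e : h⁻¹ • (P (s + h) - P s) - P' s =
              h⁻¹ • (P (s + h) - (s + h) • P' s - (P s - s • P' s)) := by
            have : P (s + h) - (s + h) • P' s - (P s - s • P' s)
                = (P (s + h) - P s) - h • P' s := by module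
            rw [this, smul_sub _ _ (h • P' s), smul_smul, inv_mul_cancel₀ h0.ne', one_smul]
          rw [e, norm_smul, norm_inv, Real.norm_of_nonneg h0.le]
          rw [add_sub_cancel_left, Real.norm_of_nonneg h0.le] at hmv
          rw [inv_mul_le_iff₀ h0]
          linarith
      _ ≤ _ := by
          rw [setLIntegral_const]
          gcongr
          linarith
  refine ENNReal.tendsto_nhds_zero.2 fun ε hε => ?_
  have ht : Tendsto (fun r : ℝ => ENNReal.ofReal r ^ 2 * volume (Ioo a c)) (𝓝[>] 0) (𝓝 0) := by
    have h1 : Tendsto (fun r : ℝ => ENNReal.ofReal r ^ 2) (𝓝[>] 0) (𝓝 0) :=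
      (((ENNReal.continuous_pow 2).comp ENNReal.continuous_ofReal).tendsto' 0 0
        (by simp)).mono_left nhdsWithin_le_nhds
    simpa using ENNReal.Tendsto.mul_const h1 (Or.inr (by simp))
  obtain ⟨r, hr, hr0⟩ := ((ENNReal.tendsto_nhds_zero.1 ht ε hε).and self_mem_nhdsWithin).exists
  exact (hbound r hr0).mono fun h hh => hh.trans hr

/-- Uniqueness of `L²` limits along shrinking domains; it identifies the abstract velocity trace `z`
with an explicit expression. -/
theorem ae_eq_of_tendsto_lintegral_sub {X : Type*} [NormedAddCommGroup X] {a c : ℝ}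
    {Yh : ℝ → ℝ → X} {Y Z : ℝ → X}
    (hY : MemLp Y 2 (volume.restrict (Ioo a c))) (hZ : MemLp Z 2 (volume.restrict (Ioo a c)))
    (hm : ∀ᶠ h in 𝓝[>] 0, AEStronglyMeasurable (Yh h) (volume.restrict (Ioo a (c - h))))
    (h₁ : Tendsto (fun h => ∫⁻ s in Ioo a (c - h), ‖Yh h s - Y s‖ₑ ^ 2) (𝓝[>] 0) (𝓝 0))
    (h₂ : Tendsto (fun h => ∫⁻ s in Ioo a (c - h), ‖Yh h s - Z s‖ₑ ^ 2) (𝓝[>] 0) (𝓝 0)) :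
    ∀ᵐ s ∂volume.restrict (Ioo a c), Y s = Z s := by
  have hYm : AEStronglyMeasurable ((Ioo a c).indicator Y) volume :=
    (aestronglyMeasurable_indicator_iff measurableSet_Ioo).2 hY.1
  have hZm : AEStronglyMeasurable ((Ioo a c).indicator Z) volume :=
    (aestronglyMeasurable_indicator_iff measurableSet_Ioo).2 hZ.1
  have hsum := ENNReal.Tendsto.const_mul (a := 2) ((tendsto_lintegral_indicator_sub hY h₁).add
    (tendsto_lintegral_indicator_sub hZ h₂)) (Or.inr (by simp))
  rw [add_zero, mul_zero] at hsum
  have hle : ∫⁻ s, ‖(Ioo a c).indicator Y s - (Ioo a c).indicator Z s‖ₑ ^ 2 ≤ 0 := by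
    refine ge_of_tendsto hsum ?_
    filter_upwards [hm] with h hm
    have hm' : AEStronglyMeasurable ((Ioo a (c - h)).indicator (Yh h)) volume :=
      (aestronglyMeasurable_indicator_iff measurableSet_Ioo).2 hm
    rw [← lintegral_add_left' (f := fun s => ‖(Ioo a (c - h)).indicator (Yh h) s -
        (Ioo a c).indicator Y s‖ₑ ^ 2) ((hm'.sub hYm).enorm.pow_const 2),
      ← lintegral_const_mul' _ _ (by simp)]
    refine lintegral_mono fun s => ?_
    have htri : ∀ x y v : X, ‖x - y‖ₑ ^ 2 ≤ 2 * (‖v - x‖ₑ ^ 2 + ‖v - y‖ₑ ^ 2) := by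
      intro x y v
      have h1 : ‖x - y‖ ^ 2 ≤ 2 * (‖v - x‖ ^ 2 + ‖v - y‖ ^ 2) := by
        have h2 : ‖x - y‖ ≤ ‖v - x‖ + ‖v - y‖ := by
          rw [norm_sub_rev v x]
          exact norm_sub_le_norm_sub_add_norm_sub x v y
        nlinarith [norm_nonneg (x - y), sq_nonneg (‖v - x‖ - ‖v - y‖)]
      have h3 := ENNReal.ofReal_le_ofReal h1
      rwa [ENNReal.ofReal_mul (by norm_num), ENNReal.ofReal_add (by positivity) (by positivity),
        ENNReal.ofReal_pow (norm_nonneg _), ENNReal.ofReal_pow (norm_nonneg _),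
        ENNReal.ofReal_pow (norm_nonneg _), ofReal_norm, ofReal_norm,
        ofReal_norm, ENNReal.ofReal_ofNat] at h3
    exact htri _ _ _
  have h0 := (lintegral_eq_zero_iff' ((hYm.sub hZm).enorm.pow_const 2)).1 (le_antisymm hle zero_le)
  rw [ae_restrict_iff' measurableSet_Ioo]
  filter_upwards [h0] with s hs hmem
  simpa [hmem, sub_eq_zero] using hs

/-- `dualAdjoint B` as a bounded operator. -/
noncomputable def dualAdjointCLM {U V : Type*} [NormedAddCommGroup U] [InnerProductSpace ℝ U]
    [CompleteSpace U] [SeminormedAddCommGroup V] [NormedSpace ℝ V]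
    (B : U →L[ℝ] StrongDual ℝ V) :
    V →L[ℝ] U :=
  LinearMap.mkContinuous
    { toFun := dualAdjoint B
      map_add' := fun v₁ v₂ => ext_inner_right ℝ fun x => by
        simp [inner_add_left, inner_dualAdjoint]
      map_smul' := fun r v => ext_inner_right ℝ fun x => by
        simp [inner_smul_left, inner_dualAdjoint] }
    ‖B.flip‖ fun v => by
      change ‖dualAdjoint B v‖ ≤ _
      rw [dualAdjoint, LinearIsometryEquiv.norm_map]
      exact B.flip.le_opNorm v

@[simp]
theorem dualAdjointCLM_apply {U V : Type*} [NormedAddCommGroup U] [InnerProductSpace ℝ U]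
    [CompleteSpace U] [SeminormedAddCommGroup V] [NormedSpace ℝ V]
    (B : U →L[ℝ] StrongDual ℝ V) (v : V) :
    dualAdjointCLM B v = dualAdjoint B v := rfl

theorem dualAdjoint_smul_left {U V : Type*} [NormedAddCommGroup U] [InnerProductSpace ℝ U]
    [CompleteSpace U] [SeminormedAddCommGroup V] [NormedSpace ℝ V]
    (r : ℝ) (B : U →L[ℝ] StrongDual ℝ V)
    (v : V) : dualAdjoint (r • B) v = r • dualAdjoint B v :=
  ext_inner_right ℝ fun x => by simp [inner_smul_left, inner_dualAdjoint]

/-! ### The energy identity for each kind of damping. -/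

section

variable {H : Type*} [NormedAddCommGroup H] [InnerProductSpace ℝ H] [CompleteSpace H]
  {U : Type*} [NormedAddCommGroup U] [InnerProductSpace ℝ U] [CompleteSpace U]
  {X : Type*} [NormedAddCommGroup X] [InnerProductSpace ℝ X] [CompleteSpace X]
  {S : H →ₗ.[ℝ] H}

theorem standardEnergy_sub_eq_neg_integral_of_mem
    (L : EnergySpace S →ₗ[ℝ] X) {a c : ℝ}
    {w : ℝ → EnergySpace S} {w' : ℝ → H} {G Y : ℝ → X}
    (hw : ContinuousOn w (Icc a c))
    (hder : ∀ s ∈ Icc a c,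
      HasDerivWithinAt (fun r => EnergySpace.toH S (w r)) (w' s) (Icc a c) s)
    (hL : ContinuousOn (fun s => L (w s)) (Icc a c))
    (hG : MemLp G 2 (volume.restrict (Ioo a c))) (hY : MemLp Y 2 (volume.restrict (Ioo a c)))
    (hLY : Tendsto (fun h : ℝ => ∫⁻ s in Ioo a (c - h),
      ‖L (h⁻¹ • (w (s + h) - w s)) - Y s‖ₑ ^ 2) (𝓝[>] 0) (𝓝 0))
    (hweak : ∀ φ : EnergySpace S, ∀ s ∈ Icc a c,
      inner ℝ (w' s) (EnergySpace.toH S φ) - inner ℝ (w' a) (EnergySpace.toH S φ) +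
        ∫ r in a..s, (inner ℝ (w r) φ + inner ℝ (G r) (L φ)) = 0)
    {e : ℝ} (he : e ∈ Icc a c) :
    standardEnergy (w e) (w' e) - standardEnergy (w a) (w' a) =
      -∫ s in a..e, inner ℝ (G s) (Y s) := by
  rcases he.1.eq_or_lt with rfl | hae
  · simp
  have hsub : Icc a e ⊆ Icc a c := Icc_subset_Icc_right he.2
  have hle : volume.restrict (Ioo a e) ≤ volume.restrict (Ioo a c) :=
    Measure.restrict_mono_set _ (Ioo_subset_Ioo_right he.2)
  refine standardEnergy_sub_eq_neg_integral L hae (hw.mono hsub)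
    (fun s hs => (hder s (hsub hs)).mono hsub) (hL.mono hsub) (hG.mono_measure hle)
    (hY.mono_measure hle) ?_ fun φ s hs => hweak φ s (hsub hs)
  refine tendsto_of_tendsto_of_tendsto_of_le_of_le tendsto_const_nhds hLY
    (fun _ => zero_le) fun h => ?_
  exact lintegral_mono_set (Ioo_subset_Ioo_right (by linarith [he.2]))

theorem memLp_two_of_continuousOn {E : Type*} [NormedAddCommGroup E] {f : ℝ → E} {a c : ℝ}
    (hf : ContinuousOn f (Icc a c)) : MemLp f 2 (volume.restrict (Ioo a c)) := by
  obtain ⟨C, hC⟩ := isCompact_Icc.exists_bound_of_continuousOn hf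
  refine MemLp.of_bound ((hf.mono Ioo_subset_Icc_self).aestronglyMeasurable measurableSet_Ioo) C ?_
  exact (ae_restrict_mem measurableSet_Ioo).mono fun s hs => hC s (Ioo_subset_Icc_self hs)

/-- The energy balance under a force `G` with values in `H`. -/
theorem standardEnergy_sub_eq_neg_integral_force {a c : ℝ}
    {w : ℝ → EnergySpace S} {w' : ℝ → H} {G : ℝ → H}
    (hw : ContinuousOn w (Icc a c)) (hw' : ContinuousOn w' (Icc a c))
    (hder : ∀ s ∈ Icc a c,
      HasDerivWithinAt (fun r => EnergySpace.toH S (w r)) (w' s) (Icc a c) s)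
    (hG : MemLp G 2 (volume.restrict (Ioo a c)))
    (hweak : ∀ φ : EnergySpace S, ∀ s ∈ Icc a c,
      inner ℝ (w' s) (EnergySpace.toH S φ) - inner ℝ (w' a) (EnergySpace.toH S φ) +
        ∫ r in a..s, (inner ℝ (w r) φ + inner ℝ (G r) (EnergySpace.toH S φ)) = 0)
    {e : ℝ} (he : e ∈ Icc a c) :
    standardEnergy (w e) (w' e) - standardEnergy (w a) (w' a) =
      -∫ s in a..e, inner ℝ (G s) (w' s) := by
  refine standardEnergy_sub_eq_neg_integral_of_mem (EnergySpace.toH S) hw hder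
    (fun s hs => (hder s hs).continuousWithinAt) hG (memLp_two_of_continuousOn hw') ?_ hweak he
  simpa using tendsto_lintegral_slope_sub hder hw'

theorem intervalIntegral_congr_Ioo {E : Type*} [NormedAddCommGroup E] [NormedSpace ℝ E]
    {f g : ℝ → E} {a c s : ℝ} (hs : s ∈ Icc a c) (h : ∀ r ∈ Ioo a c, f r = g r) :
    ∫ r in a..s, f r = ∫ r in a..s, g r := by
  rw [intervalIntegral.integral_of_le hs.1, intervalIntegral.integral_of_le hs.1,
    integral_Ioc_eq_integral_Ioo, integral_Ioc_eq_integral_Ioo]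
  exact setIntegral_congr_fun measurableSet_Ioo fun r hr => h r ⟨hr.1, hr.2.trans_le hs.2⟩

theorem intervalIntegral_congr_ae_Ioo {E : Type*} [NormedAddCommGroup E] [NormedSpace ℝ E]
    {f g : ℝ → E} {a c s : ℝ} (hs : s ∈ Icc a c)
    (h : ∀ᵐ r ∂volume.restrict (Ioo a c), f r = g r) :
    ∫ r in a..s, f r = ∫ r in a..s, g r := by
  rw [intervalIntegral.integral_of_le hs.1, intervalIntegral.integral_of_le hs.1,
    integral_Ioc_eq_integral_Ioo, integral_Ioc_eq_integral_Ioo]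
  exact integral_congr_ae (ae_restrict_of_ae_restrict_of_subset (Ioo_subset_Ioo_right hs.2) h)

/-- Here `B^*` extends to `H` as the adjoint of `F`, so uniqueness of limits gives `z = F^* w'`
almost everywhere. The damping is then an `L²` force `F z` in `H`, and `(F z, w') = ‖z‖²`. -/
theorem standardEnergy_sub_eq_of_contDiffOn_damping
    {B : ℝ → U →L[ℝ] StrongDual ℝ (EnergySpace S)} {a c : ℝ}
    {F : ℝ → U →L[ℝ] H} (hF : ContinuousOn F (Icc a c))
    (hBF : ∀ s ∈ Ico a c, ∀ (x : U) (φ : EnergySpace S),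
      B s x φ = inner ℝ (F s x) (EnergySpace.toH S φ))
    {w : ℝ → EnergySpace S} {w' : ℝ → H} {z : ℝ → U} (hsol : IsDampedSolution B a c w w' z)
    {e : ℝ} (he : e ∈ Icc a c) :
    standardEnergy (w e) (w' e) - standardEnergy (w a) (w' a) = -∫ s in a..e, ‖z s‖ ^ 2 := by
  obtain ⟨⟨hz, htr⟩, hsol⟩ := hsol
  have hB : ∀ s ∈ Ico a c, ∀ φ : EnergySpace S,
      dualAdjoint (B s) φ = ContinuousLinearMap.adjoint (F s) (EnergySpace.toH S φ) :=
    fun s hs φ => ext_inner_right ℝ fun x => by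
      rw [inner_dualAdjoint, hBF s hs, ContinuousLinearMap.adjoint_inner_left, real_inner_comm]
  obtain ⟨K, hK⟩ := isCompact_Icc.exists_bound_of_continuousOn hF
  have hFm : AEStronglyMeasurable F (volume.restrict (Ioo a c)) :=
    (hF.mono Ioo_subset_Icc_self).aestronglyMeasurable measurableSet_Ioo
  have hG : MemLp (fun s => F s (z s)) 2 (volume.restrict (Ioo a c)) := by
    refine MemLp.of_le_mul (c := K) hz
      (isBoundedBilinearMap_apply.continuous.comp_aestronglyMeasurable (hFm.prodMk hz.1)) ?_
    filter_upwards [ae_restrict_mem measurableSet_Ioo] with s hs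
    exact ((F s).le_opNorm _).trans
      (mul_le_mul_of_nonneg_right (hK s (Ioo_subset_Icc_self hs)) (norm_nonneg _))
  have hadj : ContinuousOn (fun s => ContinuousLinearMap.adjoint (F s)) (Icc a c) :=
    ContinuousLinearMap.adjoint.continuous.comp_continuousOn hF
  have hYc : ContinuousOn (fun s => ContinuousLinearMap.adjoint (F s) (w' s)) (Icc a c) :=
    hadj.clm_apply hsol.continuousOn_deriv
  have hpc : ContinuousOn (fun s => EnergySpace.toH S (w s)) (Icc a c) :=
    fun s hs => (hsol.hasDeriv s hs).continuousWithinAt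
  have hslope : Tendsto (fun h : ℝ => ∫⁻ s in Ioo a (c - h),
      ‖ContinuousLinearMap.adjoint (F s)
        (h⁻¹ • (EnergySpace.toH S (w (s + h)) - EnergySpace.toH S (w s))) -
        ContinuousLinearMap.adjoint (F s) (w' s)‖ₑ ^ 2) (𝓝[>] 0) (𝓝 0) := by
    have h1 := ENNReal.Tendsto.const_mul (a := ENNReal.ofReal K ^ 2)
      (tendsto_lintegral_slope_sub hsol.hasDeriv hsol.continuousOn_deriv)
      (Or.inr (ENNReal.pow_ne_top ENNReal.ofReal_ne_top))
    rw [mul_zero] at h1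
    refine tendsto_of_tendsto_of_tendsto_of_le_of_le' tendsto_const_nhds h1
      (Eventually.of_forall fun _ => zero_le) ?_
    filter_upwards [self_mem_nhdsWithin] with h h0
    have h0 : (0 : ℝ) < h := h0
    rw [← lintegral_const_mul' _ _ (ENNReal.pow_ne_top ENNReal.ofReal_ne_top)]
    refine setLIntegral_mono' measurableSet_Ioo fun s hs => ?_
    rw [← map_sub, ← mul_pow]
    refine pow_le_pow_left' (((ContinuousLinearMap.adjoint (F s)).le_opENorm _).trans ?_) 2
    gcongr
    rw [← ofReal_norm, LinearIsometryEquiv.norm_map]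
    exact ENNReal.ofReal_le_ofReal (hK s ⟨hs.1.le, by linarith [hs.2]⟩)
  have hzae : ∀ᵐ s ∂volume.restrict (Ioo a c),
      ContinuousLinearMap.adjoint (F s) (w' s) = z s := by
    refine ae_eq_of_tendsto_lintegral_sub (memLp_two_of_continuousOn hYc) hz ?_ hslope ?_
    · filter_upwards [self_mem_nhdsWithin] with h h0
      have h0 : (0 : ℝ) < h := h0
      have hsub : Icc a (c - h) ⊆ Icc a c := Icc_subset_Icc_right (by linarith)
      refine (ContinuousOn.mono ?_ Ioo_subset_Icc_self).aestronglyMeasurable measurableSet_Ioo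
      exact (hadj.mono hsub).clm_apply
        (((hpc.comp_add_const_Icc h0).sub (hpc.mono hsub)).const_smul _)
    · refine htr.congr' ?_
      filter_upwards [self_mem_nhdsWithin] with h h0
      have h0 : (0 : ℝ) < h := h0
      refine setLIntegral_congr_fun measurableSet_Ioo fun s hs => ?_
      simp only [hB s ⟨hs.1.le, by linarith [hs.2]⟩, map_smul, map_sub]
  rw [standardEnergy_sub_eq_neg_integral_force hsol.continuousOn hsol.continuousOn_deriv
    hsol.hasDeriv hG ?_ he]
  · congr 1
    refine intervalIntegral_congr_ae_Ioo he ?_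
    filter_upwards [hzae] with s hs
    rw [← ContinuousLinearMap.adjoint_inner_right, hs, real_inner_self_eq_norm_sq]
  · intro φ s hs
    rw [← hsol.weak_eq φ s hs]
    congr 1
    refine intervalIntegral_congr_Ioo hs fun r hr => ?_
    rw [hB r (Ioo_subset_Ico_self hr), ContinuousLinearMap.adjoint_inner_right, inner_zero_left,
      add_zero]

/-- The time dependence is moved off the operator: `L = C^*` is fixed, the force is `√b z` and the
derivative of `L w` is `z / √b`, with pairing `‖z‖²`. The two bounds on `b` keep both factors in
`L²`. -/
theorem standardEnergy_sub_eq_of_sqrt_smul_damping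
    {B : ℝ → U →L[ℝ] StrongDual ℝ (EnergySpace S)} {a c : ℝ}
    {b : ℝ → ℝ} {C : U →L[ℝ] StrongDual ℝ (EnergySpace S)}
    (hbm : AEStronglyMeasurable b (volume.restrict (Ioo a c)))
    {β₀ β₁ : ℝ} (hβ₀ : 0 < β₀) (hb : ∀ s ∈ Ico a c, β₀ ≤ b s ∧ b s ≤ β₁)
    (hB : ∀ s ∈ Ico a c, B s = √(b s) • C)
    {w : ℝ → EnergySpace S} {w' : ℝ → H} {z : ℝ → U} (hsol : IsDampedSolution B a c w w' z)
    {e : ℝ} (he : e ∈ Icc a c) :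
    standardEnergy (w e) (w' e) - standardEnergy (w a) (w' a) = -∫ s in a..e, ‖z s‖ ^ 2 := by
  obtain ⟨⟨hz, htr⟩, hsol⟩ := hsol
  have hpos : ∀ s ∈ Ico a c, 0 < √(b s) := fun s hs =>
    Real.sqrt_pos.2 (hβ₀.trans_le (hb s hs).1)
  have hinv : ∀ s ∈ Ico a c, (√(b s))⁻¹ ≤ (√β₀)⁻¹ := fun s hs =>
    inv_anti₀ (Real.sqrt_pos.2 hβ₀) (Real.sqrt_le_sqrt (hb s hs).1)
  have hsm : AEStronglyMeasurable (fun s => √(b s)) (volume.restrict (Ioo a c)) :=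
    Real.continuous_sqrt.comp_aestronglyMeasurable hbm
  have hG : MemLp (fun s => √(b s) • z s) 2 (volume.restrict (Ioo a c)) := by
    refine MemLp.of_le_mul (c := √β₁) hz (hsm.smul hz.1) ?_
    filter_upwards [ae_restrict_mem measurableSet_Ioo] with s hs
    have hs' := Ioo_subset_Ico_self hs
    rw [norm_smul, Real.norm_of_nonneg (hpos s hs').le]
    exact mul_le_mul_of_nonneg_right (Real.sqrt_le_sqrt (hb s hs').2) (norm_nonneg _)
  have hY : MemLp (fun s => (√(b s))⁻¹ • z s) 2 (volume.restrict (Ioo a c)) := by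
    refine MemLp.of_le_mul (c := (√β₀)⁻¹) hz
      (hsm.aemeasurable.inv.aestronglyMeasurable.smul hz.1) ?_
    filter_upwards [ae_restrict_mem measurableSet_Ioo] with s hs
    have hs' := Ioo_subset_Ico_self hs
    rw [norm_smul, Real.norm_of_nonneg (inv_pos.2 (hpos s hs')).le]
    exact mul_le_mul_of_nonneg_right (hinv s hs') (norm_nonneg _)
  have hLY : Tendsto (fun h : ℝ => ∫⁻ s in Ioo a (c - h),
      ‖dualAdjointCLM C (h⁻¹ • (w (s + h) - w s)) - (√(b s))⁻¹ • z s‖ₑ ^ 2)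
      (𝓝[>] 0) (𝓝 0) := by
    have h1 := ENNReal.Tendsto.const_mul (a := ENNReal.ofReal (√β₀)⁻¹ ^ 2) htr
      (Or.inr (ENNReal.pow_ne_top ENNReal.ofReal_ne_top))
    rw [mul_zero] at h1
    refine tendsto_of_tendsto_of_tendsto_of_le_of_le' tendsto_const_nhds h1
      (Eventually.of_forall fun _ => zero_le) ?_
    filter_upwards [self_mem_nhdsWithin] with h h0
    have h0 : (0 : ℝ) < h := h0
    rw [← lintegral_const_mul' _ _ (ENNReal.pow_ne_top ENNReal.ofReal_ne_top)]
    refine setLIntegral_mono' measurableSet_Ioo fun s hs => ?_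
    have hs' : s ∈ Ico a c := ⟨hs.1.le, by linarith [hs.2]⟩
    rw [hB s hs', dualAdjoint_smul_left, ← mul_pow]
    refine pow_le_pow_left' ?_ 2
    have e1 : dualAdjointCLM C (h⁻¹ • (w (s + h) - w s)) - (√(b s))⁻¹ • z s =
        (√(b s))⁻¹ • (√(b s) • dualAdjoint C (h⁻¹ • (w (s + h) - w s)) - z s) := by
      rw [smul_sub (√(b s))⁻¹ (√(b s) • _), smul_smul, inv_mul_cancel₀ (hpos s hs').ne', one_smul,
        dualAdjointCLM_apply]
    rw [e1, enorm_smul, Real.enorm_of_nonneg (inv_pos.2 (hpos s hs')).le]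
    exact mul_le_mul_left (ENNReal.ofReal_le_ofReal (hinv s hs')) _
  rw [standardEnergy_sub_eq_neg_integral_of_mem (dualAdjointCLM C).toLinearMap hsol.continuousOn
    hsol.hasDeriv ((dualAdjointCLM C).continuous.comp_continuousOn hsol.continuousOn) hG hY hLY
    ?_ he]
  · congr 1
    refine intervalIntegral_congr_Ioo he fun s hs => ?_
    rw [real_inner_smul_left, real_inner_smul_right, ← mul_assoc,
      mul_inv_cancel₀ (hpos s (Ioo_subset_Ico_self hs)).ne', one_mul, real_inner_self_eq_norm_sq]
  · intro φ s hs
    rw [← hsol.weak_eq φ s hs]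
    congr 1
    refine intervalIntegral_congr_Ioo hs fun r hr => ?_
    rw [hB r (Ioo_subset_Ico_self hr), dualAdjoint_smul_left, inner_zero_left, add_zero,
      real_inner_smul_left, real_inner_smul_right]
    rfl

/-- All difference quotients vanish, so `z = 0` almost everywhere and the energy is conserved. -/
theorem standardEnergy_sub_eq_of_dualAdjoint_eq_zero
    {B : ℝ → U →L[ℝ] StrongDual ℝ (EnergySpace S)} {a c : ℝ}
    (hB : ∀ s ∈ Ico a c, ∀ φ, dualAdjoint (B s) φ = 0)
    {w : ℝ → EnergySpace S} {w' : ℝ → H} {z : ℝ → U} (hsol : IsDampedSolution B a c w w' z)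
    {e : ℝ} (he : e ∈ Icc a c) :
    standardEnergy (w e) (w' e) - standardEnergy (w a) (w' a) = -∫ s in a..e, ‖z s‖ ^ 2 := by
  obtain ⟨⟨hz, htr⟩, hsol⟩ := hsol
  have hz0 : ∀ᵐ s ∂volume.restrict (Ioo a c), (0 : U) = z s := by
    refine ae_eq_of_tendsto_lintegral_sub (Yh := fun _ _ => 0) (Y := fun _ => 0) (by simp) hz
      (Eventually.of_forall fun _ => aestronglyMeasurable_const) (by simp) (htr.congr' ?_)
    filter_upwards [self_mem_nhdsWithin] with h h0
    have h0 : (0 : ℝ) < h := h0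
    refine setLIntegral_congr_fun measurableSet_Ioo fun s hs => ?_
    simp only [hB s ⟨hs.1.le, by linarith [hs.2]⟩]
  rw [standardEnergy_sub_eq_neg_integral_force (G := fun _ => 0) hsol.continuousOn
    hsol.continuousOn_deriv hsol.hasDeriv (by simp) ?_ he]
  · congr 1
    refine intervalIntegral_congr_ae_Ioo he ?_
    filter_upwards [hz0] with s hs
    simp [← hs]
  · intro φ s hs
    rw [← hsol.weak_eq φ s hs]
    congr 1
    refine intervalIntegral_congr_Ioo hs fun r hr => ?_
    rw [hB r (Ioo_subset_Ico_self hr), inner_zero_right, add_zero]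

/-- The energy identity for the damped system. -/
theorem IsDampedSolution.standardEnergy_sub_eq
    {B : ℝ → U →L[ℝ] StrongDual ℝ (EnergySpace S)} {a c : ℝ}
    (hadm : AdmissibleDamping B a c) (j : EnergySpace S → U) {m M : ℝ} (hm : 0 < m)
    (hj : ∀ s ∈ Ico a c, ∀ v : EnergySpace S,
      m * ‖j v‖ ^ 2 ≤ ‖dualAdjoint (B s) v‖ ^ 2 ∧ ‖dualAdjoint (B s) v‖ ^ 2 ≤ M * ‖j v‖ ^ 2)
    {w : ℝ → EnergySpace S} {w' : ℝ → H} {z : ℝ → U} (hsol : IsDampedSolution B a c w w' z)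
    {e : ℝ} (he : e ∈ Icc a c) :
    standardEnergy (w e) (w' e) - standardEnergy (w a) (w' a) = -∫ s in a..e, ‖z s‖ ^ 2 := by
  rcases he.1.eq_or_lt with rfl | hae
  · simp
  have ha : a ∈ Ico a c := ⟨le_rfl, hae.trans_le he.2⟩
  rcases hadm with ⟨F, hF, hBF⟩ | ⟨b, C, hb, hb0, hBC⟩
  · exact standardEnergy_sub_eq_of_contDiffOn_damping hF.continuousOn hBF hsol he
  have hsq : ∀ s ∈ Ico a c, ∀ v, ‖dualAdjoint (B s) v‖ ^ 2 = b s * ‖dualAdjoint C v‖ ^ 2 := by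
    intro s hs v
    rw [hBC s hs, dualAdjoint_smul_left, norm_smul, mul_pow, Real.norm_of_nonneg (Real.sqrt_nonneg _),
      Real.sq_sqrt (hb0 s hs).le]
  by_cases hC : ∀ v, dualAdjoint C v = 0
  · refine standardEnergy_sub_eq_of_dualAdjoint_eq_zero (fun s hs φ => ?_) hsol he
    rw [hBC s hs, dualAdjoint_smul_left, hC, smul_zero]
  push Not at hC
  obtain ⟨v, hv⟩ := hC
  have hκ : 0 < ‖dualAdjoint C v‖ ^ 2 := by positivity
  -- Positivity of `b` on `[a, c)` does not bound it away from zero near `c`. The two-sided estimate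
  -- on `B^*`, read at one `v` with `C^* v ≠ 0`, does; its upper half first forces `j v ≠ 0`.
  have hjv : 0 < ‖j v‖ ^ 2 := by
    have h1 := (hj a ha v).2
    rw [hsq a ha] at h1
    refine lt_of_le_of_ne (by positivity) fun h0 => ?_
    rw [← h0, mul_zero] at h1
    exact (mul_pos (hb0 a ha) hκ).not_ge h1
  refine standardEnergy_sub_eq_of_sqrt_smul_damping (β₀ := m * ‖j v‖ ^ 2 / ‖dualAdjoint C v‖ ^ 2)
    (β₁ := M * ‖j v‖ ^ 2 / ‖dualAdjoint C v‖ ^ 2) hb.1.1 (by positivity) (fun s hs => ?_) hBC hsol he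
  have h1 := hj s hs v
  rw [hsq s hs] at h1
  exact ⟨(div_le_iff₀ hκ).2 h1.1, (le_div_iff₀ hκ).2 h1.2⟩

end

/-! ### The scalar recursion. -/

/-- Since `q` may come close to zero, `ε / q` need not be summable and factoring out `q` is no use.
Instead `x` is first bounded by `K`, as `q + ε ≤ exp ε`; then `ε n * x n ≤ K * ε n` is an additive
error, and from a late index `k` on these errors sum to little while the product kills the rest. -/
theorem tendsto_zero_of_le_add_mul {x q ε : ℕ → ℝ} (hx : ∀ n, 0 ≤ x n) (hq : ∀ n, 0 < q n)
    (hq1 : ∀ n, q n ≤ 1) (hε : ∀ n, 0 ≤ ε n) (hsum : Summable ε)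
    (hprod : Tendsto (fun N => ∏ n ∈ Finset.range N, q n) atTop (𝓝 0))
    (hrec : ∀ n, x (n + 1) ≤ (q n + ε n) * x n) : Tendsto x atTop (𝓝 0) := by
  set K := x 0 * Real.exp (∑' n, ε n)
  have hK0 : 0 ≤ K := mul_nonneg (hx 0) (Real.exp_pos _).le
  have hbound : ∀ N, x N ≤ K := by
    have h1 : ∀ N, x N ≤ x 0 * Real.exp (∑ n ∈ Finset.range N, ε n) := by
      intro N
      induction N with
      | zero => simp
      | succ N ih =>
        rw [Finset.sum_range_succ, Real.exp_add]
        calc x (N + 1) ≤ (q N + ε N) * x N := hrec N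
          _ ≤ Real.exp (ε N) * (x 0 * Real.exp (∑ n ∈ Finset.range N, ε n)) := by
            refine mul_le_mul ?_ ih (hx N) (Real.exp_pos _).le
            linarith [hq1 N, Real.add_one_le_exp (ε N)]
          _ = _ := by ring
    exact fun N => (h1 N).trans (mul_le_mul_of_nonneg_left
      (Real.exp_le_exp.2 (hsum.sum_le_tsum _ fun n _ => hε n)) (hx 0))
  set P : ℕ → ℝ := fun N => ∏ n ∈ Finset.range N, q n
  set s : ℕ → ℝ := fun N => ∑ n ∈ Finset.range N, ε n
  have hPpos : ∀ N, 0 < P N := fun N => Finset.prod_pos fun n _ => hq n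
  have hstep : ∀ k N, k ≤ N → x N ≤ P N / P k * x k + K * (s N - s k) := by
    intro k N hkN
    induction N, hkN using Nat.le_induction with
    | base => simp [(hPpos k).ne']
    | succ N _ ih =>
      have hPs : P (N + 1) = P N * q N := Finset.prod_range_succ _ _
      have hSs : s (N + 1) = s N + ε N := Finset.sum_range_succ _ _
      have hnn : 0 ≤ K * (s N - s k) :=
        mul_nonneg hK0 (sub_nonneg.2 (Finset.sum_le_sum_of_subset_of_nonneg
          (Finset.range_mono ‹k ≤ N›) fun n _ _ => hε n))
      have h1 : q N * x N ≤ q N * (P N / P k * x k) + K * (s N - s k) := by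
        refine (mul_le_mul_of_nonneg_left ih (hq N).le).trans ?_
        rw [mul_add]
        exact add_le_add le_rfl (mul_le_of_le_one_left hnn (hq1 N))
      have h2 : ε N * x N ≤ K * ε N := by
        rw [mul_comm]; exact mul_le_mul_of_nonneg_right (hbound N) (hε N)
      calc x (N + 1) ≤ q N * x N + ε N * x N := by rw [← add_mul]; exact hrec N
        _ ≤ q N * (P N / P k * x k) + K * (s N - s k) + K * ε N := add_le_add h1 h2
        _ = _ := by rw [hPs, hSs]; ring
  have hs_le : ∀ N, s N ≤ ∑' n, ε n := fun N => hsum.sum_le_tsum _ fun n _ => hε n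
  have htail : Tendsto (fun k => K * ((∑' n, ε n) - s k)) atTop (𝓝 0) := by
    have := (hsum.hasSum.tendsto_sum_nat.const_sub (∑' n, ε n)).const_mul K
    simpa using this
  refine (tendsto_order.2 ⟨fun δ hδ => Eventually.of_forall fun n => hδ.trans_le (hx n),
    fun δ hδ => ?_⟩)
  obtain ⟨k, hk⟩ := (htail.eventually (gt_mem_nhds (half_pos hδ))).exists
  have hfirst : Tendsto (fun N => P N / P k * x k) atTop (𝓝 0) := by
    simpa using (hprod.div_const (P k)).mul_const (x k)
  filter_upwards [hfirst.eventually (gt_mem_nhds (half_pos hδ)), eventually_ge_atTop k]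
    with N h1 h2
  have h3 : K * (s N - s k) ≤ K * ((∑' n, ε n) - s k) := by gcongr; exact hs_le N
  linarith [hstep k N h2]

theorem tendsto_prod_sqrt_of_sum_log_atBot {r : ℕ → ℝ} (hr : ∀ n, 0 < r n)
    (h : Tendsto (fun N => ∑ n ∈ Finset.range N, Real.log (r n)) atTop atBot) :
    Tendsto (fun N => ∏ n ∈ Finset.range N, √(r n)) atTop (𝓝 0) := by
  have h1 := (Real.tendsto_exp_atBot.comp h).sqrt
  rw [Real.sqrt_zero] at h1
  refine h1.congr fun N => ?_
  rw [Function.comp, Real.exp_sum, Real.sqrt_prod _ fun n _ => (Real.exp_pos _).le]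
  exact Finset.prod_congr rfl fun n _ => by rw [Real.exp_log (hr n)]

/-! ### Restarting the weak equation, and growth under the delayed feedback. -/

theorem MeasureTheory.MemLp.integrable_real_inner {α E : Type*} [MeasurableSpace α]
    [NormedAddCommGroup E] [InnerProductSpace ℝ E] {μ : Measure α} {f g : α → E}
    (hf : MemLp f 2 μ) (hg : MemLp g 2 μ) : Integrable (fun x => inner ℝ (f x) (g x)) μ :=
  (hf.norm.integrable_mul hg.norm).mono' (hf.1.inner hg.1)
    (Eventually.of_forall fun _ => norm_inner_le_norm _ _)

section

variable {H : Type*} [NormedAddCommGroup H] [InnerProductSpace ℝ H]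
  {U : Type*} [NormedAddCommGroup U] [InnerProductSpace ℝ U] [CompleteSpace U]
  {S : H →ₗ.[ℝ] H}

theorem AdmissibleDamping.aestronglyMeasurable_dualAdjoint [CompleteSpace H]
    {B : ℝ → U →L[ℝ] StrongDual ℝ (EnergySpace S)} {a c : ℝ} (hadm : AdmissibleDamping B a c)
    (φ : EnergySpace S) :
    AEStronglyMeasurable (fun s => dualAdjoint (B s) φ) (volume.restrict (Ioo a c)) := by
  rcases hadm with ⟨F, hF, hBF⟩ | ⟨b, C, hb, hb0, hBC⟩
  · have hc : ContinuousOn (fun s => ContinuousLinearMap.adjoint (F s) (EnergySpace.toH S φ))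
        (Ioo a c) :=
      ((ContinuousLinearMap.adjoint.continuous.comp_continuousOn hF.continuousOn).clm_apply
        continuousOn_const).mono Ioo_subset_Icc_self
    refine (hc.aestronglyMeasurable measurableSet_Ioo).congr ?_
    filter_upwards [ae_restrict_mem measurableSet_Ioo] with s hs
    refine ext_inner_right ℝ fun x => ?_
    rw [inner_dualAdjoint, hBF s (Ioo_subset_Ico_self hs), ContinuousLinearMap.adjoint_inner_left,
      real_inner_comm]
  · refine ((Real.continuous_sqrt.comp_aestronglyMeasurable hb.1.1).smul_const
      (dualAdjoint C φ)).congr ?_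
    filter_upwards [ae_restrict_mem measurableSet_Ioo] with s hs
    rw [hBC s (Ioo_subset_Ico_self hs), dualAdjoint_smul_left]

theorem memLp_dualAdjoint [CompleteSpace H]
    {B : ℝ → U →L[ℝ] StrongDual ℝ (EnergySpace S)} {a c : ℝ}
    (hadm : AdmissibleDamping B a c) {j : EnergySpace S → U} {M : ℝ}
    (hj : ∀ s ∈ Ico a c, ∀ v : EnergySpace S, ‖dualAdjoint (B s) v‖ ^ 2 ≤ M * ‖j v‖ ^ 2)
    (φ : EnergySpace S) :
    MemLp (fun s => dualAdjoint (B s) φ) 2 (volume.restrict (Ioo a c)) := by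
  refine MemLp.of_bound (hadm.aestronglyMeasurable_dualAdjoint φ) (√(M * ‖j φ‖ ^ 2)) ?_
  filter_upwards [ae_restrict_mem measurableSet_Ioo] with s hs
  exact Real.le_sqrt_of_sq_le (hj s (Ioo_subset_Ico_self hs) φ)

theorem intervalIntegrable_weak_integrand {B : ℝ → U →L[ℝ] StrongDual ℝ (EnergySpace S)}
    {a c : ℝ} (hac : a ≤ c) {w : ℝ → EnergySpace S} {z : ℝ → U} {f : ℝ → H} {φ : EnergySpace S}
    (hw : ContinuousOn w (Icc a c)) (hz : MemLp z 2 (volume.restrict (Ioo a c)))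
    (hB : MemLp (fun s => dualAdjoint (B s) φ) 2 (volume.restrict (Ioo a c)))
    (hf : MemLp f 2 (volume.restrict (Ioo a c))) :
    IntervalIntegrable (fun r => inner ℝ (w r) φ + inner ℝ (z r) (dualAdjoint (B r) φ) +
      inner ℝ (f r) (EnergySpace.toH S φ)) volume a c := by
  rw [intervalIntegrable_iff_integrableOn_Ioo_of_le hac]
  have hq : MemLp (fun s => EnergySpace.sqrtMap S (w s)) 2 (volume.restrict (Ioo a c)) :=
    memLp_two_of_continuousOn ((EnergySpace.continuous_sqrtMap S).comp_continuousOn hw)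
  exact ((hq.integrable_real_inner (memLp_const (EnergySpace.sqrtMap S φ))).add
    (hz.integrable_real_inner hB)).add (hf.integrable_real_inner (memLp_const _))

/-- Moves the initial time from `o` to `a`. Splitting the integral at `a` is legitimate only for
integrable pieces, hence the two integrability hypotheses. -/
theorem IsWeakSolution.weak_eq_of_le {B : ℝ → U →L[ℝ] StrongDual ℝ (EnergySpace S)} {f : ℝ → H}
    {w : ℝ → EnergySpace S} {w' : ℝ → H} {z : ℝ → U} {o : ℝ}
    (hsol : IsWeakSolution B f o (Ici o) w w' z) {φ : EnergySpace S} {a s : ℝ} (ha : o ≤ a)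
    (has : a ≤ s)
    (hint₁ : IntervalIntegrable (fun r => inner ℝ (w r) φ + inner ℝ (z r) (dualAdjoint (B r) φ) +
      inner ℝ (f r) (EnergySpace.toH S φ)) volume o a)
    (hint₂ : IntervalIntegrable (fun r => inner ℝ (w r) φ + inner ℝ (z r) (dualAdjoint (B r) φ) +
      inner ℝ (f r) (EnergySpace.toH S φ)) volume a s) :
    inner ℝ (w' s) (EnergySpace.toH S φ) - inner ℝ (w' a) (EnergySpace.toH S φ) +
      ∫ r in a..s, (inner ℝ (w r) φ + inner ℝ (z r) (dualAdjoint (B r) φ) +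
        inner ℝ (f r) (EnergySpace.toH S φ)) = 0 := by
  have h1 := hsol.weak_eq φ a ha
  have h2 := hsol.weak_eq φ s (ha.trans has)
  rw [← intervalIntegral.integral_add_adjacent_intervals hint₁ hint₂] at h2
  linarith

theorem standardEnergy_nonneg (v : EnergySpace S) (v' : H) : 0 ≤ standardEnergy v v' := by
  unfold standardEnergy; positivity

theorem norm_le_sqrt_two_mul_sqrt_standardEnergy (v : EnergySpace S) (v' : H) :
    ‖v'‖ ≤ √2 * √(standardEnergy v v') := by
  rw [← Real.sqrt_mul zero_le_two]
  refine Real.le_sqrt_of_sq_le ?_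
  unfold standardEnergy
  nlinarith [sq_nonneg ‖v‖]

/-- Growth of the energy when the delayed feedback acts. -/
theorem sqrt_standardEnergy_le_of_delay [CompleteSpace H] {V₂ W : Type*} [NormedAddCommGroup V₂]
    [InnerProductSpace ℝ V₂] [CompleteSpace V₂] [NormedAddCommGroup W] [InnerProductSpace ℝ W]
    {a c τ M E₀ : ℝ} {w : ℝ → EnergySpace S} {w' : ℝ → H} {B₂ : ℝ → V₂ →L[ℝ] H} (jW : H →L[ℝ] W)
    (hM : 0 ≤ M)
    (hw : ContinuousOn w (Icc a c)) (hw' : ContinuousOn w' (Icc a c))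
    (hbal : ∀ e ∈ Icc a c, standardEnergy (w e) (w' e) - standardEnergy (w a) (w' a) =
      -∫ s in a..e, inner ℝ (B₂ s (ContinuousLinearMap.adjoint (B₂ s) (w' (s - τ)))) (w' s))
    (hB₂ : ∀ s ∈ Ico a c, ∀ v : H,
      ‖ContinuousLinearMap.adjoint (B₂ s) v‖ ^ 2 ≤ M * ‖jW v‖ ^ 2)
    (hdelay : ∀ s ∈ Ico a c, standardEnergy (w (s - τ)) (w' (s - τ)) ≤ E₀)
    {s : ℝ} (hs : s ∈ Icc a c) :
    √(standardEnergy (w s) (w' s)) ≤ √(standardEnergy (w a) (w' a)) +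
      2 * ‖jW‖ ^ 2 * (M * (c - a)) * √E₀ := by
  have hac : a ≤ c := hs.1.trans hs.2
  have hEc : ContinuousOn (fun s => standardEnergy (w s) (w' s)) (Icc a c) :=
    ((hw.norm.pow 2).add (hw'.norm.pow 2)).div_const 2
  -- Evaluating the balance where the energy is largest closes the estimate without Gronwall: the
  -- maximum `X` controls the undelayed velocity, `E₀` the delayed one.
  obtain ⟨e, he, hmax⟩ := isCompact_Icc.exists_isMaxOn (nonempty_Icc.2 hac) hEc
  set X := standardEnergy (w e) (w' e) with hX
  have hX0 : 0 ≤ X := standardEnergy_nonneg _ _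
  have hadj : ∀ r ∈ Ico a c, ∀ v : H,
      ‖ContinuousLinearMap.adjoint (B₂ r) v‖ ≤ √M * ‖jW‖ * ‖v‖ := by
    intro r hr v
    refine (Real.le_sqrt_of_sq_le (hB₂ r hr v)).trans ?_
    rw [Real.sqrt_mul hM, Real.sqrt_sq (norm_nonneg _), mul_assoc]
    exact mul_le_mul_of_nonneg_left (jW.le_opNorm v) (Real.sqrt_nonneg _)
  have hpt : ∀ r ∈ Ico a c,
      ‖inner ℝ (B₂ r (ContinuousLinearMap.adjoint (B₂ r) (w' (r - τ)))) (w' r)‖ ≤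
        2 * ‖jW‖ ^ 2 * M * √E₀ * √X := by
    intro r hr
    rw [← ContinuousLinearMap.adjoint_inner_right]
    have h1 : ‖w' (r - τ)‖ ≤ √2 * √E₀ :=
      (norm_le_sqrt_two_mul_sqrt_standardEnergy (w (r - τ)) _).trans
        (mul_le_mul_of_nonneg_left (Real.sqrt_le_sqrt (hdelay r hr)) (Real.sqrt_nonneg _))
    have h2 : ‖w' r‖ ≤ √2 * √X :=
      (norm_le_sqrt_two_mul_sqrt_standardEnergy (w r) _).trans
        (mul_le_mul_of_nonneg_left (Real.sqrt_le_sqrt (hmax ⟨hr.1, hr.2.le⟩))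
          (Real.sqrt_nonneg _))
    calc _ ≤ _ := norm_inner_le_norm _ _
      _ ≤ (√M * ‖jW‖ * (√2 * √E₀)) * (√M * ‖jW‖ * (√2 * √X)) := by
          refine mul_le_mul ((hadj r hr _).trans ?_) ((hadj r hr _).trans ?_) (norm_nonneg _)
            (by positivity) <;> gcongr
      _ = (√2 * √2) * ‖jW‖ ^ 2 * (√M * √M) * √E₀ * √X := by ring
      _ = _ := by rw [Real.mul_self_sqrt zero_le_two, Real.mul_self_sqrt hM]
  have hint := intervalIntegral.norm_integral_le_of_norm_le_const_ae (a := a) (b := e)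
    (C := 2 * ‖jW‖ ^ 2 * M * √E₀ * √X)
    (f := fun r => inner ℝ (B₂ r (ContinuousLinearMap.adjoint (B₂ r) (w' (r - τ)))) (w' r)) (by
      -- The bounds hold on `[a, c)` only, so the end point is discarded as a null set.
      filter_upwards [Measure.ae_ne volume c] with r hr hmem
      rw [uIoc_of_le he.1] at hmem
      exact hpt r ⟨hmem.1.le, lt_of_le_of_ne (hmem.2.trans he.2) hr⟩)
  rw [Real.norm_eq_abs, abs_of_nonneg (sub_nonneg.2 he.1)] at hint
  have hmain : X ≤ standardEnergy (w a) (w' a) + 2 * (‖jW‖ ^ 2 * (M * (c - a)) * √E₀) * √X := by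
    have h1 := hbal e he
    have h2 : 2 * ‖jW‖ ^ 2 * M * √E₀ * √X * (e - a) ≤ 2 * ‖jW‖ ^ 2 * M * √E₀ * √X * (c - a) :=
      mul_le_mul_of_nonneg_left (by linarith [he.2]) (by positivity)
    linarith [(abs_le.1 hint).1]
  set D := ‖jW‖ ^ 2 * (M * (c - a)) * √E₀ with hD
  have hD0 : 0 ≤ D := by have := sub_nonneg.2 hac; positivity
  set y := √(standardEnergy (w a) (w' a)) with hy
  have hy0 : 0 ≤ y := Real.sqrt_nonneg _
  have hy2 : y ^ 2 = standardEnergy (w a) (w' a) := Real.sq_sqrt (standardEnergy_nonneg _ _)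
  have hX2 : √X ^ 2 = X := Real.sq_sqrt hX0
  -- From `X ≤ y² + 2 D √X`: if `√X > y + 2D`, then `X > (y + 2D) √X ≥ y² + 2 D √X`.
  have hle : √X ≤ y + 2 * D := by
    by_contra! hlt
    nlinarith [Real.sqrt_nonneg X]
  calc √(standardEnergy (w s) (w' s)) ≤ √X := Real.sqrt_le_sqrt (hmax hs)
    _ ≤ y + 2 * D := hle
    _ = _ := by rw [hD]; ring

end

/-! ### Decay of the energy. -/

theorem tendsto_zero_of_le_on_intervals {t : ℕ → ℝ} (hmono : Monotone t)
    (htop : Tendsto t atTop atTop) {f : ℝ → ℝ} {y : ℕ → ℝ} (hf : ∀ s, 0 ≤ f s)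
    (hle : ∀ n, ∀ s ∈ Icc (t n) (t (n + 1)), f s ≤ y n) (hy : Tendsto y atTop (𝓝 0)) :
    Tendsto f atTop (𝓝 0) := by
  refine tendsto_order.2 ⟨fun δ hδ => Eventually.of_forall fun s => hδ.trans_le (hf s),
    fun δ hδ => ?_⟩
  obtain ⟨N, hN⟩ := eventually_atTop.1 (hy.eventually (gt_mem_nhds hδ))
  filter_upwards [eventually_ge_atTop (t N)] with s hs
  have hex : ∃ n, s < t (n + 1) :=
    (((tendsto_add_atTop_iff_nat 1).2 htop).eventually (eventually_gt_atTop s)).exists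
  classical
  have hn := Nat.find_spec hex
  have hNn : N ≤ Nat.find hex := by
    by_contra! hlt
    exact absurd (hn.trans_le (hmono (Nat.succ_le_of_lt hlt))) (not_lt.2 hs)
  refine (hle (Nat.find hex) s ⟨?_, hn.le⟩).trans_lt (hN _ hNn)
  rcases h : Nat.find hex with _ | k
  · rw [h] at hNn
    rwa [Nat.le_zero.1 hNn] at hs
  · exact not_lt.1 (Nat.find_min hex (h ▸ Nat.lt_succ_self k))

theorem theorem4p3
    {H : Type*} [NormedAddCommGroup H] [InnerProductSpace ℝ H] [CompleteSpace H]
    {U₁ : Type*} [NormedAddCommGroup U₁] [InnerProductSpace ℝ U₁] [CompleteSpace U₁]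
    {U₂ : Type*} [NormedAddCommGroup U₂] [InnerProductSpace ℝ U₂] [CompleteSpace U₂]
    {W : Type*} [NormedAddCommGroup W] [InnerProductSpace ℝ W] [CompleteSpace W]
    -- the operator `A` and its square root `S = A^{1/2}`; `V = D(A^{1/2})` is `EnergySpace S`
    (A S : H →ₗ.[ℝ] H) (hA : IsPosSelfAdjointCompactInverse A) (hS : IsPosSqrt S A)
    -- the delay and the switching times
    (τ : ℝ) (hτ : 0 < τ) (t : ℕ → ℝ) (ht0 : t 0 = 0) (ht : ∀ n, t n < t (n + 1))
    (hT_even : ∀ n, τ ≤ t (2 * n + 1) - t (2 * n))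
    (hT_odd : ∀ n, t (2 * n + 2) - t (2 * n + 1) ≤ τ)
    -- the feedback operators
    (B₁ : ℝ → U₁ →L[ℝ] StrongDual ℝ (EnergySpace S)) (B₂ : ℝ → U₂ →L[ℝ] H)
    (hB₂_zero : ∀ n, ∀ s ∈ Ico (t (2 * n)) (t (2 * n + 1)), B₂ s = 0)
    (hB₁_zero : ∀ n, ∀ s ∈ Ico (t (2 * n + 1)) (t (2 * n + 2)), B₁ s = 0)
    (hB₂_cont : ∀ n, ∃ F : ℝ → U₂ →L[ℝ] H,
      ContinuousOn F (Icc (t (2 * n + 1)) (t (2 * n + 2))) ∧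
      ∀ s ∈ Ico (t (2 * n + 1)) (t (2 * n + 2)), B₂ s = F s)
    (hB₁_adm : ∀ n, AdmissibleDamping B₁ (t (2 * n)) (t (2 * n + 1)))
    -- the maps `V → U₁` and `H → W`, and the bounds i), ii)
    (jU : EnergySpace S →L[ℝ] U₁) (jW : H →L[ℝ] W) (m M : ℕ → ℝ)
    (hm : ∀ n, 0 < m (2 * n)) (hmM : ∀ n, m (2 * n) ≤ M (2 * n))
    (hM : ∀ n, 0 < M (2 * n + 1))
    (h_i : ∀ n, ∀ s ∈ Ico (t (2 * n)) (t (2 * n + 1)), ∀ v : EnergySpace S,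
      m (2 * n) * ‖jU v‖ ^ 2 ≤ ‖dualAdjoint (B₁ s) v‖ ^ 2 ∧
      ‖dualAdjoint (B₁ s) v‖ ^ 2 ≤ M (2 * n) * ‖jU v‖ ^ 2)
    (h_ii : ∀ n, ∀ s ∈ Ico (t (2 * n + 1)) (t (2 * n + 2)), ∀ v : H,
      ‖ContinuousLinearMap.adjoint (B₂ s) v‖ ^ 2 ≤ M (2 * n + 1) * ‖jW v‖ ^ 2)
    -- the observability type inequality, with constant `d n T` for the time `T`
    (Tbar : ℕ → ℝ) (hTbar_nonneg : ∀ n, 0 ≤ Tbar n)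
    (hTbar : ∀ n, Tbar n < t (2 * n + 1) - t (2 * n))
    (d : ℕ → ℝ → ℝ)
    (hd : ∀ n T, Tbar n < T → T ≤ t (2 * n + 1) - t (2 * n) → 0 < d n T)
    (h_obs : ∀ n T, Tbar n < T → T ≤ t (2 * n + 1) - t (2 * n) →
      ∀ (w : ℝ → EnergySpace S) (w' : ℝ → H) (z : ℝ → U₁),
        IsDampedSolution B₁ (t (2 * n)) (t (2 * n + 1)) w w' z →
        standardEnergy (w (t (2 * n) + T)) (w' (t (2 * n) + T)) ≤
          d n T * ∫ s in t (2 * n)..(t (2 * n) + T), ‖z s‖ ^ 2)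
    -- the two series conditions, `d n` being taken at the time `T_{2n}`
    (h_sum : Summable fun n => M (2 * n + 1) * (t (2 * n + 2) - t (2 * n + 1)))
    (h_log : Tendsto (fun N => ∑ n ∈ Finset.range N,
      Real.log (d n (t (2 * n + 1) - t (2 * n)) / (d n (t (2 * n + 1) - t (2 * n)) + 1)))
      atTop atBot)
    -- an arbitrary solution
    (u : ℝ → EnergySpace S) (u' : ℝ → H) (z : ℝ → U₁)
    (hu : IsDelaySolution B₁ B₂ τ t u u' z) :
    Tendsto (fun s => standardEnergy (u s) (u' s)) atTop (𝓝 0) := by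
  have hmono : StrictMono t := strictMono_nat_of_lt_succ ht
  have htnn : ∀ n, 0 ≤ t n := fun n => ht0 ▸ hmono.monotone (Nat.zero_le n)
  obtain ⟨hutr, husol⟩ := hu
  set f : ℝ → H := fun s => B₂ s (ContinuousLinearMap.adjoint (B₂ s) (u' (s - τ))) with hf
  have hsubI : ∀ n, Icc (t n) (t (n + 1)) ⊆ Ici 0 := fun n s hs => (htnn n).trans hs.1
  have huc : ∀ n, ContinuousOn u (Icc (t n) (t (n + 1))) := fun n =>
    husol.continuousOn.mono (hsubI n)
  have huc' : ∀ n, ContinuousOn u' (Icc (t n) (t (n + 1))) := fun n =>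
    husol.continuousOn_deriv.mono (hsubI n)
  have hder : ∀ n, ∀ s ∈ Icc (t n) (t (n + 1)),
      HasDerivWithinAt (fun r => EnergySpace.toH S (u r)) (u' s) (Icc (t n) (t (n + 1))) s :=
    fun n s hs => (husol.hasDeriv s (hsubI n hs)).mono (hsubI n)
  have hf_even : ∀ n, ∀ s ∈ Ico (t (2 * n)) (t (2 * n + 1)), f s = 0 := fun n s hs => by
    simp [hf, hB₂_zero n s hs]
  have hB₁_dual : ∀ n, ∀ s ∈ Ico (t (2 * n + 1)) (t (2 * n + 2)), ∀ φ,
      dualAdjoint (B₁ s) φ = 0 := fun n s hs φ =>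
    ext_inner_right ℝ fun x => by simp [inner_dualAdjoint, hB₁_zero n s hs]
  -- `T_{2n} ≥ τ` keeps the delayed time after `t (2n)`, and `T_{2n+1} ≤ τ` keeps it before `t
  -- (2n+1)`: the delay only sees the damped phase.
  have hdelay_mem : ∀ n, ∀ s ∈ Icc (t (2 * n + 1)) (t (2 * n + 2)),
      s - τ ∈ Icc (t (2 * n)) (t (2 * n + 1)) := fun n s hs =>
    ⟨by linarith [hs.1, hT_even n], by linarith [hs.2, hT_odd n]⟩
  have hf_mem : ∀ n, MemLp f 2 (volume.restrict (Ioo (t n) (t (n + 1)))) := by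
    intro n
    obtain ⟨k, rfl | rfl⟩ := Nat.even_or_odd' n
    · refine (memLp_congr_ae (f := fun _ => (0 : H)) ?_).1 (by simp)
      filter_upwards [ae_restrict_mem measurableSet_Ioo] with s hs
      exact (hf_even k s (Ioo_subset_Ico_self hs)).symm
    · obtain ⟨F, hF, hBF⟩ := hB₂_cont k
      have hc : ContinuousOn (fun s => F s (ContinuousLinearMap.adjoint (F s) (u' (s - τ))))
          (Icc (t (2 * k + 1)) (t (2 * k + 2))) :=
        hF.clm_apply ((ContinuousLinearMap.adjoint.continuous.comp_continuousOn hF).clm_apply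
          ((huc' (2 * k)).comp (by fun_prop) (hdelay_mem k)))
      refine (memLp_congr_ae ?_).1 (memLp_two_of_continuousOn hc)
      filter_upwards [ae_restrict_mem measurableSet_Ioo] with s hs
      simp only [hf, hBF s (Ioo_subset_Ico_self hs)]
  have hB_mem : ∀ n φ, MemLp (fun s => dualAdjoint (B₁ s) φ) 2
      (volume.restrict (Ioo (t n) (t (n + 1)))) := by
    intro n φ
    obtain ⟨k, rfl | rfl⟩ := Nat.even_or_odd' n
    · exact memLp_dualAdjoint (hB₁_adm k) (fun s hs v => (h_i k s hs v).2) φ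
    · refine (memLp_congr_ae (f := fun _ => (0 : U₁)) ?_).1 (by simp)
      filter_upwards [ae_restrict_mem measurableSet_Ioo] with s hs
      exact (hB₁_dual k s (Ioo_subset_Ico_self hs) φ).symm
  have hint : ∀ n φ, IntervalIntegrable (fun r => inner ℝ (u r) φ +
      inner ℝ (z r) (dualAdjoint (B₁ r) φ) + inner ℝ (f r) (EnergySpace.toH S φ))
      volume (t n) (t (n + 1)) := fun n φ =>
    intervalIntegrable_weak_integrand (ht n).le (huc n) (hutr n).1 (hB_mem n φ) (hf_mem n)
  have hint₀ : ∀ n φ, IntervalIntegrable (fun r => inner ℝ (u r) φ +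
      inner ℝ (z r) (dualAdjoint (B₁ r) φ) + inner ℝ (f r) (EnergySpace.toH S φ))
      volume 0 (t n) := by
    intro n φ
    have := IntervalIntegrable.trans_iterate (n := n) fun k _ => hint k φ
    rwa [ht0] at this
  have hweak : ∀ n φ, ∀ s ∈ Icc (t n) (t (n + 1)),
      inner ℝ (u' s) (EnergySpace.toH S φ) - inner ℝ (u' (t n)) (EnergySpace.toH S φ) +
        ∫ r in t n..s, (inner ℝ (u r) φ + inner ℝ (z r) (dualAdjoint (B₁ r) φ) +
          inner ℝ (f r) (EnergySpace.toH S φ)) = 0 := fun n φ s hs =>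
    husol.weak_eq_of_le (htnn n) hs.1 (hint₀ n φ) ((hint n φ).mono_set
      (by rw [uIcc_of_le hs.1, uIcc_of_le (ht n).le]; exact Icc_subset_Icc_right hs.2))
  have hdamp : ∀ n, IsDampedSolution B₁ (t (2 * n)) (t (2 * n + 1)) u u' z := by
    intro n
    refine ⟨hutr (2 * n), huc _, huc' _, hder _, fun φ s hs => ?_⟩
    rw [← hweak (2 * n) φ s hs]
    congr 1
    refine intervalIntegral_congr_Ioo hs fun r hr => ?_
    rw [hf_even n r (Ioo_subset_Ico_self hr)]
  set E : ℝ → ℝ := fun s => standardEnergy (u s) (u' s) with hE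
  have hE0 : ∀ s, 0 ≤ E s := fun s => standardEnergy_nonneg _ _
  have hbal_even : ∀ n, ∀ s ∈ Icc (t (2 * n)) (t (2 * n + 1)),
      E s - E (t (2 * n)) = -∫ r in t (2 * n)..s, ‖z r‖ ^ 2 := fun n s hs =>
    (hdamp n).standardEnergy_sub_eq (hB₁_adm n) jU (hm n) (h_i n) hs
  have hE_even : ∀ n, ∀ s ∈ Icc (t (2 * n)) (t (2 * n + 1)), E s ≤ E (t (2 * n)) := by
    intro n s hs
    have h1 : 0 ≤ ∫ r in t (2 * n)..s, ‖z r‖ ^ 2 :=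
      intervalIntegral.integral_nonneg hs.1 fun r _ => by positivity
    linarith [hbal_even n s hs]
  have hbal_odd : ∀ n, ∀ s ∈ Icc (t (2 * n + 1)) (t (2 * n + 2)),
      E s - E (t (2 * n + 1)) = -∫ r in t (2 * n + 1)..s, inner ℝ (f r) (u' r) := by
    intro n s hs
    refine standardEnergy_sub_eq_neg_integral_force (huc (2 * n + 1)) (huc' (2 * n + 1))
      (hder (2 * n + 1)) (hf_mem (2 * n + 1)) (fun φ r hr => ?_) hs
    rw [← hweak (2 * n + 1) φ r hr]
    congr 1
    refine intervalIntegral_congr_Ioo hr fun v hv => ?_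
    rw [hB₁_dual n v (Ioo_subset_Ico_self hv), inner_zero_right, add_zero]
  set δ : ℕ → ℝ := fun n => d n (t (2 * n + 1) - t (2 * n)) with hδ
  have hδ0 : ∀ n, 0 < δ n := fun n => hd n _ (hTbar n) le_rfl
  have hE_obs : ∀ n, E (t (2 * n + 1)) ≤ δ n / (δ n + 1) * E (t (2 * n)) := by
    intro n
    have h1 := h_obs n _ (hTbar n) le_rfl u u' z (hdamp n)
    have h2 := hbal_even n (t (2 * n + 1)) (right_mem_Icc.2 (ht _).le)
    rw [add_sub_cancel] at h1
    -- The observed integral is exactly the energy lost; solving for `E (t (2n+1))` gives the factor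
    -- `δ/(δ+1)`.
    have h3 : E (t (2 * n + 1)) ≤ δ n * (E (t (2 * n)) - E (t (2 * n + 1))) := by
      have : E (t (2 * n)) - E (t (2 * n + 1)) = ∫ r in t (2 * n)..t (2 * n + 1), ‖z r‖ ^ 2 := by
        linarith
      rw [this]
      exact h1
    rw [div_mul_eq_mul_div, le_div_iff₀ (by linarith [hδ0 n])]
    linarith
  set ε : ℕ → ℝ := fun n => 2 * ‖jW‖ ^ 2 * (M (2 * n + 1) * (t (2 * n + 2) - t (2 * n + 1)))
    with hε
  have hε0 : ∀ n, 0 ≤ ε n := fun n => by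
    have := sub_nonneg.2 (ht (2 * n + 1)).le
    have := (hM n).le
    positivity
  have hE_odd : ∀ n, ∀ s ∈ Icc (t (2 * n + 1)) (t (2 * n + 2)),
      √(E s) ≤ √(E (t (2 * n + 1))) + ε n * √(E (t (2 * n))) := fun n s hs =>
    sqrt_standardEnergy_le_of_delay jW (hM n).le (huc (2 * n + 1)) (huc' (2 * n + 1))
      (hbal_odd n) (h_ii n)
      (fun r hr => hE_even n _ (hdelay_mem n r (Ico_subset_Icc_self hr))) hs
  have hratio0 : ∀ n, 0 < δ n / (δ n + 1) := fun n =>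
    div_pos (hδ0 n) (by linarith [hδ0 n])
  have hratio1 : ∀ n, δ n / (δ n + 1) ≤ 1 := fun n =>
    (div_le_one (by linarith [hδ0 n])).2 (by linarith)
  have hrec : ∀ n, √(E (t (2 * (n + 1)))) ≤
      (√(δ n / (δ n + 1)) + ε n) * √(E (t (2 * n))) := by
    intro n
    rw [add_mul, ← Real.sqrt_mul (hratio0 n).le]
    exact (hE_odd n _ (right_mem_Icc.2 (ht (2 * n + 1)).le)).trans
      (add_le_add_left (Real.sqrt_le_sqrt (hE_obs n)) _)
  have hlim : Tendsto (fun n => √(E (t (2 * n)))) atTop (𝓝 0) :=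
    tendsto_zero_of_le_add_mul (fun n => Real.sqrt_nonneg _)
      (fun n => Real.sqrt_pos.2 (hratio0 n)) (fun n => Real.sqrt_le_one.2 (hratio1 n))
      hε0 (h_sum.mul_left _) (tendsto_prod_sqrt_of_sum_log_atBot hratio0 h_log) hrec
  have htop : Tendsto (fun n => t (2 * n)) atTop atTop := by
    have hge : ∀ n : ℕ, n * τ ≤ t (2 * n) := by
      intro n
      induction n with
      | zero => simp [ht0]
      | succ n ih =>
        push_cast
        have h1 : t (2 * n + 1) ≤ t (2 * (n + 1)) := (ht (2 * n + 1)).le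
        linarith [hT_even n]
    exact tendsto_atTop_mono hge (tendsto_natCast_atTop_atTop.atTop_mul_const hτ)
  have hsqrt : Tendsto (fun s => √(E s)) atTop (𝓝 0) := by
    -- Between `t (2n)` and `t (2n+2)`, `√E` exceeds its initial value by at most the factor `1 + ε
    -- n`, which tends to `1`.
    refine tendsto_zero_of_le_on_intervals (y := fun n => (1 + ε n) * √(E (t (2 * n))))
      (hmono.monotone.comp fun a b hab => Nat.mul_le_mul_left 2 hab) htop
      (fun s => Real.sqrt_nonneg _) (fun n s hs => ?_) ?_
    · have hs2 : s ≤ t (2 * n + 2) := hs.2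
      rw [one_add_mul]
      rcases le_total s (t (2 * n + 1)) with h1 | h1
      · exact (Real.sqrt_le_sqrt (hE_even n s ⟨hs.1, h1⟩)).trans
          (le_add_of_nonneg_right (mul_nonneg (hε0 n) (Real.sqrt_nonneg _)))
      · refine (hE_odd n s ⟨h1, hs2⟩).trans (add_le_add_left (Real.sqrt_le_sqrt ?_) _)
        exact hE_even n _ (right_mem_Icc.2 (ht _).le)
    · have := ((h_sum.mul_left (2 * ‖jW‖ ^ 2)).tendsto_atTop_zero.const_add 1).mul hlim
      simpa using this
  have := hsqrt.pow 2
  simp only [Real.sq_sqrt (hE0 _), ne_eq, OfNat.ofNat_ne_zero, not_false_eq_true, zero_pow] at this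
  exact this
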